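/- **Setting.** Time is slotted, packets have equal size, and each link carries at most one packet per slot. An $N\times N$ crossbar switch has $N$ input and $N$ output links and can realize every permutation between them in each slot; a fiber delay line with delay $d$ delivers in slot $s+d$ the packet that entered it in slot $s$. A system with an $N\times N$ switch and $M$ delay lines ($N\ge M+2$) connects $M$ output links of the switch through the delay lines back to $M$ of its input links; one further input link is the arrival link, two further output links are the departure link and the loss link, and any remaining links are unused. The permutation used in a slot is chosen by a controller from the arrivals, priorities and departure requests of all slots up to and including the current one. All delay lines are initially empty. Packets are strictly ordered by priorities revealed on arrival. For slot $t$ let $a(t),d(t),l(t)\in\{0,1\}$ be the numbers of packets on the arrival, departure and loss links, let $c(t)=1$ if there is a departure request and $c(t)=0$ otherwise, and let $q(t)$ be the number of packets in the delay lines after slot $t$. For a packet $i$ that is buffered or arriving in slot $t$, let $r_i(t)=j$ if $i$ has the $j$-th highest priority among the packets that are buffered or arriving in slot $t$. The system is a *priority queue with buffer $B$* if, for every sequence of arrivals, priorities and requests and for every $t$: 1. no packet appears or disappears, and $q(t)=q(t-1)+a(t)-d(t)-l(t)$; 2. $d(t)=1$ if and only if $c(t)=1$ and $q(t-1)+a(t)>0$;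 3. $l(t)=1$ if and only if $c(t)=0$, $q(t-1)=B$ and $a(t)=1$; moreover $l(t)=\max(q(t-1)+a(t)-d(t)-B,\,0)$; 4. a packet $i$ departing in slot $t$ has $r_i(t)=1$; 5. a packet $i$ lost in slot $t$ has $r_i(t)=B+1$. **Theorem.** For every integer $m\ge 1$, a priority queue with buffer $3\cdot 2^{m-1}-2$ can be constructed with a single $(12m^2+56m-2)\times(12m^2+56m-2)$ crossbar switch and $12(m^2-2m+3)$ fiber delay lines. Moreover, an $(M+2)\times(M+2)$ crossbar switch and $M$ fiber delay lines achieve buffer $2^{\Omega(\sqrt M)}$: there is a constant $c>0$ such that for all sufficiently large $M$ there is a $B\ge 2^{c\sqrt M}$ for which a priority queue with buffer $B$ can be constructed with a single $(M+2)\times(M+2)$ crossbar switch and $M$ fiber delay lines. -/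

import Mathlib

namespace OpticalQueue

/-- What happens at the outside of a priority queue in one time slot: possibly a packet arrives,
carrying a priority in the linear order `α` (a larger element is a higher priority), and
possibly the controller sends a departure request. -/
structure SlotInput (α : Type) where
  arrival : Option α
  request : Bool

/-- No two packets have the same priority, so that the packets are strictly ordered. -/
def DistinctPriorities {α : Type} (input : ℕ → SlotInput α) : Prop :=
  ∀ s t : ℕ, ∀ x : α, (input s).arrival = some x → (input t).arrival = some x → s = t

/-- The state (1 or 0) of a link, according to whether it carries a packet. -/
def linkState {β : Type} (link : Option β) : ℕ := if link.isSome then 1 else 0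

/-- The observed behaviour of a queueing element. At most one packet arrives per slot, so a packet
is named by the slot in which it arrives. `stored t` is the set of packets in the queue just before
slot `t` (that is, at the end of slot `t - 1`); `departure t` and `loss t` are the packets (if any)
on the departure link and on the loss link in slot `t`. -/
structure QueueTrace where
  stored : ℕ → Finset ℕ
  departure : ℕ → Option ℕ
  loss : ℕ → Option ℕ

namespace QueueTrace

variable {α : Type} [LinearOrder α]

/-- The buffered packets together with the arriving packet (if any) in slot `t`. -/
def present (T : QueueTrace) (input : ℕ → SlotInput α) (t : ℕ) : Finset ℕ :=
  if (input t).arrival.isSome then insert t (T.stored t) else T.stored t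

open Classical in
/-- The priority order `r_i(t)` of packet `i` among the packets present in slot `t`:
it is `j` if `i` has the `j`-th highest priority. -/
noncomputable def rank (T : QueueTrace) (input : ℕ → SlotInput α) (i t : ℕ) : ℕ :=
  ((T.present input t).filter fun k =>
    ∃ x y : α, (input k).arrival = some x ∧ (input i).arrival = some y ∧ y < x).card + 1

/-- The trace `T` is that of a priority queue with buffer `B`, initially empty, fed with `input`.
Here `q t = (T.stored t).card` is the number of packets in the queue before slot `t`. -/
structure IsPriorityQueue (T : QueueTrace) (input : ℕ → SlotInput α) (B : ℕ) : Prop where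
  initially_empty : T.stored 0 = ∅
  /-- No packet appears or disappears: the packets present in a slot are those that are
  stored afterwards, together with the departing one and the lost one. -/
  flow : ∀ t, T.stored (t + 1) ∪ (T.departure t).toFinset ∪ (T.loss t).toFinset
    = T.present input t
  /-- Flow conservation. -/
  flow_conservation : ∀ t, ((T.stored (t + 1)).card : ℤ) = (T.stored t).card
    + linkState (input t).arrival - linkState (T.departure t) - linkState (T.loss t)
  /-- Non-idling. -/
  non_idling : ∀ t, linkState (T.departure t) =
    if (input t).request = true ∧ 0 < (T.stored t).card + linkState (input t).arrival
    then 1 else 0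
  /-- Maximum buffer usage. -/
  loss_iff_full : ∀ t, linkState (T.loss t) =
    if (input t).request = false ∧ (T.stored t).card = B ∧ linkState (input t).arrival = 1
    then 1 else 0
  loss_eq_excess : ∀ t, (linkState (T.loss t) : ℤ) =
    max ((T.stored t).card + linkState (input t).arrival - linkState (T.departure t) - B) 0
  /-- Priority departure. -/
  priority_departure : ∀ t i, T.departure t = some i →
    i ∈ T.present input t ∧ T.rank input i t = 1
  /-- Priority loss. -/
  priority_loss : ∀ t i, T.loss t = some i →
    i ∈ T.present input t ∧ T.rank input i t = B + 1

end QueueTrace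

/-- A single `N × N` crossbar switch with `M` fibre delay lines.
Input link `k < M` of the switch is the end of delay line `k`, input link `M` is the external
arrival link, and the other input links are idle. Output link `k < M` of the switch is the
beginning of delay line `k`, output link `M` is the departure link, output link `M + 1` is the loss
link, and the other output links are not connected.
(A line of delay `0` would lead from the switch directly back to the switch in the same slot, where
a suitable permutation has the same effect, so all delays are taken to be positive.) -/
structure SDLSystem (N M : ℕ) where
  ports : M + 2 ≤ N
  delay : Fin M → ℕ
  delay_pos : ∀ k, 0 < delay k

/-- The switch is set in each slot by an electronic controller, to any permutation (from input links
to output links), depending on what has happened up to and including this slot: the argument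
is the list of the inputs of slots `0, …, t`. -/
abbrev Controller (α : Type) (N : ℕ) : Type := List (SlotInput α) → Equiv.Perm (Fin N)

namespace Controller

variable {α : Type} {N : ℕ}

/-- The permutation realized in slot `t`. -/
def setting (ctrl : Controller α N) (input : ℕ → SlotInput α) (t : ℕ) : Equiv.Perm (Fin N) :=
  ctrl ((List.range (t + 1)).map input)

end Controller

namespace SDLSystem

variable {α : Type} {N M : ℕ}

/-- The packet on output link `j` of the switch in slot `t`, where all delay lines are empty before
slot `0`. It is the packet on the input link that the switch connects to `j`; a packet that
enters a line of delay `d` in slot `s` leaves it in slot `s + d`. -/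
def output (S : SDLSystem N M) (ctrl : Controller α N) (input : ℕ → SlotInput α)
    (t : ℕ) (j : Fin N) : Option ℕ :=
  let p : Fin N := (ctrl.setting input t).symm j
  if hp : (p : ℕ) < M then
    if _ht : S.delay ⟨p, hp⟩ ≤ t then S.output ctrl input (t - S.delay ⟨p, hp⟩) p else none
  else if (p : ℕ) = M then (input t).arrival.map (fun _ => t)
  else none
termination_by t
decreasing_by
  exact Nat.sub_lt_of_pos_le (S.delay_pos ⟨p, hp⟩) _ht

open Classical in
/-- The packets inside the delay lines just before slot `t`: those that entered
a line `k` in a slot `s < t` and leave it in slot `s + S.delay k ≥ t`. -/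
noncomputable def stored (S : SDLSystem N M) (ctrl : Controller α N) (input : ℕ → SlotInput α)
    (t : ℕ) : Finset ℕ :=
  (Finset.range t).filter fun i => ∃ k : Fin M, ∃ s : ℕ, s < t ∧ t ≤ s + S.delay k ∧
    S.output ctrl input s ⟨k, by have := S.ports; omega⟩ = some i

/-- The behaviour of the system as a queueing element. -/
noncomputable def trace (S : SDLSystem N M) (ctrl : Controller α N) (input : ℕ → SlotInput α) :
    QueueTrace where
  stored := S.stored ctrl input
  departure := fun t => S.output ctrl input t ⟨M, by have := S.ports; omega⟩
  loss := fun t => S.output ctrl input t ⟨M + 1, by have := S.ports; omega⟩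

end SDLSystem

/-- A priority queue with buffer `B` can be constructed with an `N × N` crossbar switch
and `M` fibre delay lines: for suitable delays and a suitable controller, the system is a
priority queue with buffer `B` whatever the arrivals, their priorities and the requests are. -/
def PriorityQueueConstructible (B N M : ℕ) : Prop :=
  ∃ S : SDLSystem N M, ∀ (α : Type) [LinearOrder α], ∃ ctrl : Controller α N,
    ∀ input : ℕ → SlotInput α, DistinctPriorities input →
      (S.trace ctrl input).IsPriorityQueue input B

end OpticalQueue

/-! The proof schedules the packets of an ideal priority queue (`idealTrace`) on the delay lines. A
schedule that never puts two packets into the same line in the same slot, and lets packets leave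
only at line ends, is an `Itinerary`. If it also depends causally on the input, `exists_controller`
carries it out, because the switch realizes every permutation.

A packet preceded by `n` packets in priority gets slack `min n (B - n)`. It can leave the queue only
with slack 0. Its slack changes by at most 1 per slot (`slack_lipschitz`), and at most `2 * w`
packets have slack in a window of length `w` (`card_slack_le`). So a packet of large slack may be
put out of reach for a while. Packets of slack in `[2 * 2 ^ j, 4 * 2 ^ j)` enter multiplexer `j`, a
FIFO queue with 8 outputs (for `j = 0`, all slacks below 4). Inside it the slacks stay in a window
of length `4 * 2 ^ j`, so it holds at most `8 * 2 ^ j` packets and every wait is at most `2 ^ j`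
(`exit_le_succ`). Hence a packet re-emerges before its slack is used up and is assigned anew. It can
only move to a neighbouring level, so at most `3 * 8 + 1 = 25` packets enter a multiplexer per slot
(`card_entering_le`).

The wait is fixed on entry by a ticket number and realized by lines of delay `2 ^ a`, one for each
binary digit 1, lowest digit first. Packets for the same output that enter stage `a` together came
in within fewer than `2 ^ a` slots of each other, so their exits differ by less than `(25 / 8) * 2 ^
a`. These exits also differ by a multiple of `2 * 2 ^ a`, so two parallel lines, chosen by a parity,
avoid collisions (`BoardInvariant.line_inj`). With `L` levels this takes `8 * (L * (L + 1))` lines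
and serves every `B < 2 ^ (L + 2)`. -/

namespace OpticalQueue

/-! ### Itineraries and their realization by the switch -/

/-- `fl t i = some (k, s)` says that just before slot `t` packet `i` is inside delay line `k`, which
it entered in slot `s`. An itinerary describes how the packets move through the delay lines
when the system behaves like the trace `T`. -/
structure Itinerary {α : Type} {N M : ℕ} (S : SDLSystem N M) (input : ℕ → SlotInput α)
    (T : QueueTrace) (fl : ℕ → ℕ → Option (Fin M × ℕ)) : Prop where
  stored_iff : ∀ t i, i ∈ T.stored t ↔ ∃ x, fl t i = some x
  in_transit : ∀ t i k s, fl t i = some (k, s) → s < t ∧ t ≤ s + S.delay k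
  inj : ∀ t i i' x, fl t i = some x → fl t i' = some x → i = i'
  stay : ∀ t i k s, fl t i = some (k, s) → t < s + S.delay k → fl (t + 1) i = some (k, s)
  move : ∀ t i k s, fl t i = some (k, s) → t = s + S.delay k → i ∈ T.stored (t + 1) →
    ∃ k', fl (t + 1) i = some (k', t)
  enter : ∀ t, t ∈ T.stored (t + 1) → ∃ k', fl (t + 1) t = some (k', t)
  leave : ∀ t i, T.departure t = some i ∨ T.loss t = some i → i ∈ T.stored t →
    ∃ k s, fl t i = some (k, s) ∧ t = s + S.delay k
  stored_succ : ∀ t i, i ∈ T.stored (t + 1) ↔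
    (i ∈ T.stored t ∨ i = t ∧ (input t).arrival.isSome) ∧
      T.departure t ≠ some i ∧ T.loss t ≠ some i
  leave_present : ∀ t i, T.departure t = some i ∨ T.loss t = some i →
    i ∈ T.stored t ∨ i = t ∧ (input t).arrival.isSome
  departure_ne_loss : ∀ t i, T.departure t = some i → T.loss t ≠ some i

/-- Packet `i` is on input link `p` of the switch in slot `t`. -/
def AtLink {α : Type} {N M : ℕ} (S : SDLSystem N M) (input : ℕ → SlotInput α)
    (fl : ℕ → ℕ → Option (Fin M × ℕ)) (t i : ℕ) (p : Fin N) : Prop :=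
  (∃ k s, (p : ℕ) = (k : Fin M) ∧ fl t i = some (k, s) ∧ t = s + S.delay k) ∨
    ((p : ℕ) = M ∧ (input t).arrival.isSome ∧ i = t)

/-- Packet `i` is to be on output link `j` of the switch in slot `t`. -/
def Target {N M : ℕ} (T : QueueTrace) (fl : ℕ → ℕ → Option (Fin M × ℕ)) (t i : ℕ) (j : Fin N) :
    Prop :=
  (∃ k, (j : ℕ) = (k : Fin M) ∧ fl (t + 1) i = some (k, t)) ∨
    ((j : ℕ) = M ∧ T.departure t = some i) ∨ ((j : ℕ) = M + 1 ∧ T.loss t = some i)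

/-- The permutation `π` brings every packet to its target in slot `t`. -/
def Routes {α : Type} {N M : ℕ} (S : SDLSystem N M) (input : ℕ → SlotInput α)
    (T : QueueTrace) (fl : ℕ → ℕ → Option (Fin M × ℕ)) (t : ℕ) (π : Equiv.Perm (Fin N)) : Prop :=
  ∀ i p, AtLink S input fl t i p → Target T fl t i (π p)

/-- A partial injection between finite types of the same size extends to a permutation. -/
theorem exists_perm_of_injective_relation {β : Type*} [Fintype β] (R : β → β → Prop)
    (hr : ∀ x y y', R x y → R x y' → y = y') (hl : ∀ x x' y, R x y → R x' y → x = x') :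
    ∃ π : Equiv.Perm β, ∀ x y, R x y → π x = y := by
  classical
  let s : Finset β := Finset.univ.filter fun x => ∃ y, R x y
  let f : β → β := fun x => if h : ∃ y, R x y then h.choose else x
  have hf : ∀ x, (∃ y, R x y) → R x (f x) := by
    intro x h
    have : f x = h.choose := dif_pos h
    rw [this]; exact h.choose_spec
  obtain ⟨g, hg⟩ := Finset.exists_equiv_extend_of_card_eq (t := (Finset.univ : Finset β))
    (by simp) (s := s) (f := f) (by simp) (by
      intro x hx y hy hxy
      have hx' := hf x (by simpa [s] using hx)
      have hy' := hf y (by simpa [s] using hy)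
      rw [← hxy] at hy'
      exact hl _ _ _ hx' hy')
  refine ⟨g.trans (Equiv.subtypeUnivEquiv (by simp)), fun x y h => ?_⟩
  have h1 := hg x (by simp only [s, Finset.mem_filter, Finset.mem_univ, true_and]; exact ⟨y, h⟩)
  have h2 := hr x _ _ (hf x ⟨y, h⟩) h
  simp [h1, h2]

namespace Itinerary

variable {α : Type} {N M : ℕ} {S : SDLSystem N M} {input : ℕ → SlotInput α}
  {T : QueueTrace} {fl : ℕ → ℕ → Option (Fin M × ℕ)}

theorem lt_of_mem_stored (h : Itinerary S input T fl) {t i : ℕ} (hi : i ∈ T.stored t) : i < t := by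
  induction t with
  | zero =>
    obtain ⟨⟨k, s⟩, hx⟩ := (h.stored_iff _ _).1 hi
    exact absurd (h.in_transit _ _ _ _ hx).1 (by omega)
  | succ t ih =>
    rcases ((h.stored_succ t i).1 hi).1 with h1 | ⟨h1, -⟩
    · have := ih h1; omega
    · omega

/-- The rules `stay`, `move` and `enter` cover all packets stored after the slot, so they can be
read backwards. -/
theorem eq_or_of_succ (h : Itinerary S input T fl) {t i : ℕ} {k : Fin M} {s : ℕ}
    (hi : fl (t + 1) i = some (k, s)) :
    s = t ∨ (fl t i = some (k, s) ∧ t < s + S.delay k) := by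
  have hm : i ∈ T.stored (t + 1) := (h.stored_iff _ _).2 ⟨_, hi⟩
  rcases ((h.stored_succ t i).1 hm).1 with h1 | ⟨h1, -⟩
  · obtain ⟨⟨k', s'⟩, hx⟩ := (h.stored_iff _ _).1 h1
    rcases (h.in_transit _ _ _ _ hx).2.lt_or_eq with h2 | h2
    · have h3 := h.stay _ _ _ _ hx h2
      rw [hi] at h3
      obtain ⟨rfl, rfl⟩ : k = k' ∧ s = s' := by simpa using h3
      exact Or.inr ⟨hx, h2⟩
    · obtain ⟨k'', h3⟩ := h.move _ _ _ _ hx h2 hm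
      rw [hi] at h3
      obtain ⟨-, rfl⟩ : k = k'' ∧ s = t := by simpa using h3
      exact Or.inl rfl
  · subst h1
    obtain ⟨k'', h3⟩ := h.enter _ hm
    rw [hi] at h3
    obtain ⟨-, rfl⟩ : k = k'' ∧ s = i := by simpa using h3
    exact Or.inl rfl

theorem persists (h : Itinerary S input T fl) {i : ℕ} {k : Fin M} {s t : ℕ} (hst : s < t)
    (ht : t ≤ s + S.delay k) : fl (s + 1) i = some (k, s) ↔ fl t i = some (k, s) := by
  induction t, hst using Nat.le_induction with
  | base => rfl
  | succ t hst ih =>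
    rw [ih (by omega)]
    constructor
    · intro h1; exact h.stay _ _ _ _ h1 (by omega)
    · intro h1
      rcases h.eq_or_of_succ h1 with h2 | h2
      · simp only [Nat.succ_eq_add_one] at hst; omega
      · exact h2.1

theorem target_functional (h : Itinerary S input T fl) {t i : ℕ} {j j' : Fin N}
    (h1 : Target T fl t i j) (h2 : Target T fl t i j') : j = j' := by
  have key : ∀ k, fl (t + 1) i = some (k, t) → T.departure t ≠ some i ∧ T.loss t ≠ some i :=
    fun k hk => ((h.stored_succ t i).1 ((h.stored_iff _ _).2 ⟨_, hk⟩)).2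
  have hne := h.departure_ne_loss t i
  rcases h1 with ⟨k, hk, h1⟩ | ⟨hk, h1⟩ | ⟨hk, h1⟩ <;>
    rcases h2 with ⟨k', hk', h2⟩ | ⟨hk', h2⟩ | ⟨hk', h2⟩
  · rw [h1] at h2
    have : k = k' := by simpa using h2
    exact Fin.ext (by rw [hk, hk', this])
  · exact absurd h2 (key _ h1).1
  · exact absurd h2 (key _ h1).2
  · exact absurd h1 (key _ h2).1
  · exact Fin.ext (by omega)
  · exact absurd h2 (hne h1)
  · exact absurd h1 (key _ h2).2
  · exact absurd h1 (hne h2)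
  · exact Fin.ext (by omega)

theorem target_injective (h : Itinerary S input T fl) {t i i' : ℕ} {j : Fin N}
    (h1 : Target T fl t i j) (h2 : Target T fl t i' j) : i = i' := by
  rcases h1 with ⟨k, hk, h1⟩ | ⟨hk, h1⟩ | ⟨hk, h1⟩ <;>
    rcases h2 with ⟨k', hk', h2⟩ | ⟨hk', h2⟩ | ⟨hk', h2⟩
  · obtain rfl : k = k' := Fin.ext (by omega)
    exact h.inj _ _ _ _ h1 h2
  · omega
  · omega
  · omega
  · rw [h1] at h2; simpa using h2
  · omega
  · omega
  · omega
  · rw [h1] at h2; simpa using h2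

theorem atLink_functional (h : Itinerary S input T fl) {t i : ℕ} {p p' : Fin N}
    (h1 : AtLink S input fl t i p) (h2 : AtLink S input fl t i p') : p = p' := by
  have key : ∀ x, fl t i = some x → i < t := fun x hx =>
    h.lt_of_mem_stored ((h.stored_iff _ _).2 ⟨x, hx⟩)
  rcases h1 with ⟨k, s, hk, h1, -⟩ | ⟨hk, -, h1⟩ <;>
    rcases h2 with ⟨k', s', hk', h2, -⟩ | ⟨hk', -, h2⟩
  · rw [h1] at h2
    have : k = k' ∧ s = s' := by simpa using h2
    exact Fin.ext (by rw [hk, hk', this.1])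
  · have := key _ h1; omega
  · have := key _ h2; omega
  · exact Fin.ext (by omega)

theorem atLink_injective (h : Itinerary S input T fl) {t i i' : ℕ} {p : Fin N}
    (h1 : AtLink S input fl t i p) (h2 : AtLink S input fl t i' p) : i = i' := by
  rcases h1 with ⟨k, s, hk, h1, hs⟩ | ⟨hk, -, h1⟩ <;>
    rcases h2 with ⟨k', s', hk', h2, hs'⟩ | ⟨hk', -, h2⟩
  · obtain rfl : k = k' := Fin.ext (by omega)
    obtain rfl : s = s' := by omega
    exact h.inj _ _ _ _ h1 h2
  · omega
  · omega
  · omega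

theorem exists_target (h : Itinerary S input T fl) {t i : ℕ} {p : Fin N}
    (h1 : AtLink S input fl t i p) : ∃ j : Fin N, Target T fl t i j := by
  have hN := S.ports
  by_cases hd : T.departure t = some i
  · exact ⟨⟨M, by omega⟩, Or.inr (Or.inl ⟨rfl, hd⟩)⟩
  by_cases hl : T.loss t = some i
  · exact ⟨⟨M + 1, by omega⟩, Or.inr (Or.inr ⟨rfl, hl⟩)⟩
  have : ∃ k, fl (t + 1) i = some (k, t) := by
    rcases h1 with ⟨k, s, hk, h1, hs⟩ | ⟨hk, ha, rfl⟩
    · exact h.move _ _ _ _ h1 hs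
        ((h.stored_succ _ _).2 ⟨Or.inl ((h.stored_iff _ _).2 ⟨_, h1⟩), hd, hl⟩)
    · exact h.enter _ ((h.stored_succ _ _).2 ⟨Or.inr ⟨rfl, ha⟩, hd, hl⟩)
  obtain ⟨k, hk⟩ := this
  exact ⟨⟨k, by omega⟩, Or.inl ⟨k, rfl, hk⟩⟩

theorem exists_atLink (h : Itinerary S input T fl) {t i : ℕ} {j : Fin N}
    (h1 : Target T fl t i j) : ∃ p : Fin N, AtLink S input fl t i p := by
  have hN := S.ports
  have h2 : (i ∈ T.stored t ∨ i = t ∧ (input t).arrival.isSome) ∧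
      (i ∈ T.stored t → ∃ k s, fl t i = some (k, s) ∧ t = s + S.delay k) := by
    rcases h1 with ⟨k, hk, h1⟩ | ⟨-, h1⟩ | ⟨-, h1⟩
    · refine ⟨((h.stored_succ t i).1 ((h.stored_iff _ _).2 ⟨_, h1⟩)).1, fun h3 => ?_⟩
      obtain ⟨⟨k', s'⟩, hx⟩ := (h.stored_iff _ _).1 h3
      obtain ⟨h4, h5⟩ := h.in_transit _ _ _ _ hx
      refine ⟨k', s', hx, ?_⟩
      by_contra h6
      have h7 := h.stay _ _ _ _ hx (by omega)
      rw [h1] at h7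
      have : k = k' ∧ t = s' := by simpa using h7
      omega
    · exact ⟨h.leave_present _ _ (Or.inl h1), h.leave _ _ (Or.inl h1)⟩
    · exact ⟨h.leave_present _ _ (Or.inr h1), h.leave _ _ (Or.inr h1)⟩
  rcases h2.1 with h3 | ⟨h3, h4⟩
  · obtain ⟨k, s, h5, h6⟩ := h2.2 h3
    exact ⟨⟨k, by omega⟩, Or.inl ⟨k, s, rfl, h5, h6⟩⟩
  · exact ⟨⟨M, by omega⟩, Or.inr ⟨rfl, h4, h3⟩⟩

/-- Each packet has at most one input link and one target, and each link at most one packet.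
Composing the two relations gives a partial injection between links, which extends to a permutation.
-/
theorem exists_routes (h : Itinerary S input T fl) (t : ℕ) : ∃ π, Routes S input T fl t π := by
  obtain ⟨π, hπ⟩ := exists_perm_of_injective_relation
    (fun p j : Fin N => ∃ i, AtLink S input fl t i p ∧ Target T fl t i j)
    (by
      rintro p j j' ⟨i, h1, h2⟩ ⟨i', h3, h4⟩
      obtain rfl := h.atLink_injective h1 h3
      exact h.target_functional h2 h4)
    (by
      rintro p p' j ⟨i, h1, h2⟩ ⟨i', h3, h4⟩
      obtain rfl := h.target_injective h2 h4
      exact h.atLink_functional h1 h3)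
  refine ⟨π, fun i p h1 => ?_⟩
  obtain ⟨j, hj⟩ := h.exists_target h1
  rw [hπ p j ⟨i, h1, hj⟩]
  exact hj

/-- What comes out of a line was put in at an earlier slot, so strong induction on the slot applies.
`persists` identifies the packet that entered then with the one now at the line's end. -/
theorem output_eq_some_iff (h : Itinerary S input T fl) (ctrl : Controller α N)
    (hc : ∀ t, Routes S input T fl t (ctrl.setting input t)) (t : ℕ) :
    ∀ j i, S.output ctrl input t j = some i ↔ Target T fl t i j := by
  induction t using Nat.strong_induction_on with
  | _ t ih =>
    intro j i
    have key : S.output ctrl input t j = some i ↔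
        AtLink S input fl t i ((ctrl.setting input t).symm j) := by
      rw [SDLSystem.output]
      set p := (ctrl.setting input t).symm j with hp
      by_cases hpM : (p : ℕ) < M
      · have hd := S.delay_pos ⟨p, hpM⟩
        simp only [hpM, dif_pos]
        by_cases ht : S.delay ⟨p, hpM⟩ ≤ t
        · simp only [ht, dif_pos]
          rw [ih _ (by omega)]
          have e : fl (t - S.delay ⟨p, hpM⟩ + 1) i = some (⟨p, hpM⟩, t - S.delay ⟨p, hpM⟩) ↔
              fl t i = some (⟨p, hpM⟩, t - S.delay ⟨p, hpM⟩) :=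
            h.persists (by omega) (by omega)
          constructor
          · rintro (⟨k, hk, h1⟩ | ⟨hk, -⟩ | ⟨hk, -⟩)
            · obtain rfl : k = ⟨p, hpM⟩ := Fin.ext hk.symm
              exact Or.inl ⟨_, _, rfl, e.1 h1, by omega⟩
            · omega
            · omega
          · rintro (⟨k, s, hk, h1, hs⟩ | ⟨hk, -⟩)
            · obtain rfl : k = ⟨p, hpM⟩ := Fin.ext hk.symm
              obtain rfl : s = t - S.delay ⟨p, hpM⟩ := by omega
              exact Or.inl ⟨_, rfl, e.2 h1⟩
            · omega
        · simp only [ht, dif_neg, not_false_eq_true, reduceCtorEq, false_iff]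
          rintro (⟨k, s, hk, h1, hs⟩ | ⟨hk, -⟩)
          · obtain rfl : k = ⟨p, hpM⟩ := Fin.ext hk.symm
            omega
          · omega
      · simp only [hpM, dif_neg, not_false_eq_true]
        have h0 : ¬ ∃ k s, (p : ℕ) = (k : Fin M) ∧ fl t i = some (k, s) ∧ t = s + S.delay k := by
          rintro ⟨k, s, hk, -⟩; omega
        unfold AtLink
        rw [or_iff_right h0]
        by_cases hpe : (p : ℕ) = M
        · simp only [hpe, if_true, true_and]
          cases (input t).arrival <;> simp [eq_comm]
        · simp [hpe]
    rw [key]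
    constructor
    · intro h1
      simpa using hc t _ _ h1
    -- A packet with a target sits on some input link. Since targets are unique, the permutation
    -- sends that link to `j`, so it is the preimage of `j`.
    · intro h1
      obtain ⟨p, hp⟩ := h.exists_atLink h1
      have h2 := h.target_functional (hc t _ _ hp) h1
      rw [← h2]
      simpa using hp

theorem trace_eq (h : Itinerary S input T fl) (ctrl : Controller α N)
    (hc : ∀ t, Routes S input T fl t (ctrl.setting input t)) : S.trace ctrl input = T := by
  have hN := S.ports
  have ho := h.output_eq_some_iff ctrl hc
  have h1 : S.stored ctrl input = T.stored := by
    funext t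
    ext i
    simp only [SDLSystem.stored, Finset.mem_filter, Finset.mem_range]
    constructor
    · rintro ⟨-, k, s, h1, h2, h3⟩
      rcases (ho _ _ _).1 h3 with ⟨k', hk, h4⟩ | ⟨hk, -⟩ | ⟨hk, -⟩
      · obtain rfl : k = k' := Fin.ext hk
        exact (h.stored_iff _ _).2 ⟨_, (h.persists h1 h2).1 h4⟩
      · have := k.2; simp only at hk; omega
      · have := k.2; simp only at hk; omega
    · intro h1
      refine ⟨h.lt_of_mem_stored h1, ?_⟩
      obtain ⟨⟨k, s⟩, hx⟩ := (h.stored_iff _ _).1 h1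
      obtain ⟨h2, h3⟩ := h.in_transit _ _ _ _ hx
      exact ⟨k, s, h2, h3, (ho _ _ _).2 (Or.inl ⟨k, rfl, (h.persists h2 h3).2 hx⟩)⟩
  have h2 : (fun t => S.output ctrl input t ⟨M, by omega⟩) = T.departure := by
    funext t
    refine Option.ext fun i => (ho _ _ _).trans ⟨?_, fun h2 => Or.inr (Or.inl ⟨rfl, h2⟩)⟩
    rintro (⟨k, hk, -⟩ | ⟨-, h2⟩ | ⟨hk, -⟩)
    · have := k.2; simp only at hk; omega
    · exact h2
    · simp only at hk; omega
  have h3 : (fun t => S.output ctrl input t ⟨M + 1, by omega⟩) = T.loss := by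
    funext t
    refine Option.ext fun i => (ho _ _ _).trans ⟨?_, fun h2 => Or.inr (Or.inr ⟨rfl, h2⟩)⟩
    rintro (⟨k, hk, -⟩ | ⟨hk, -⟩ | ⟨-, h2⟩)
    · have := k.2; simp only at hk; omega
    · simp only at hk; omega
    · exact h2
  show QueueTrace.mk _ _ _ = T
  rw [h1, h2, h3]

end Itinerary

/-- A causal family of itineraries is carried out by a controller. -/
theorem exists_controller {α : Type} {N M : ℕ} (S : SDLSystem N M)
    (T : (ℕ → SlotInput α) → QueueTrace)
    (fl : (ℕ → SlotInput α) → ℕ → ℕ → Option (Fin M × ℕ))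
    (causal : ∀ input input' t, (∀ s ≤ t, input s = input' s) →
      fl input t = fl input' t ∧ fl input (t + 1) = fl input' (t + 1) ∧
      (T input).departure t = (T input').departure t ∧ (T input).loss t = (T input').loss t) :
    ∃ ctrl : Controller α N, ∀ input, Itinerary S input (T input) (fl input) →
      S.trace ctrl input = T input := by
  classical
  -- The controller knows only a finite history. The padding by empty slots is immaterial, since by
  -- causality the routing condition in slot `t` does not see later inputs.
  let ext : List (SlotInput α) → ℕ → SlotInput α := fun hist n => hist.getD n ⟨none, false⟩
  let ctrl : Controller α N := fun hist =>
    if h : ∃ π, Routes S (ext hist) (T (ext hist)) (fl (ext hist)) (hist.length - 1) π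
    then h.choose else 1
  refine ⟨ctrl, fun input h => h.trace_eq ctrl fun t => ?_⟩
  have hlen : ((List.range (t + 1)).map input).length - 1 = t := by simp
  have hext : ∀ s ≤ t, ext ((List.range (t + 1)).map input) s = input s := by
    intro s hs
    simp only [ext, List.getD_eq_getElem?_getD]
    rw [List.getElem?_map, List.getElem?_range (by omega)]
    rfl
  obtain ⟨c1, c2, c3, c4⟩ := causal _ _ t hext
  have hiff : ∀ π, Routes S (ext ((List.range (t + 1)).map input))
      (T (ext ((List.range (t + 1)).map input))) (fl (ext ((List.range (t + 1)).map input)))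
      (((List.range (t + 1)).map input).length - 1) π ↔ Routes S input (T input) (fl input) t π := by
    intro π
    rw [hlen]
    simp only [Routes, AtLink, Target, c1, c2, c3, c4, hext t le_rfl]
  have hex : ∃ π, Routes S (ext ((List.range (t + 1)).map input))
      (T (ext ((List.range (t + 1)).map input))) (fl (ext ((List.range (t + 1)).map input)))
      (((List.range (t + 1)).map input).length - 1) π := by
    obtain ⟨π, hπ⟩ := h.exists_routes t
    exact ⟨π, (hiff π).2 hπ⟩
  rw [← hiff]
  have : ctrl.setting input t = hex.choose := dif_pos hex
  rw [this]
  exact hex.choose_spec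

/-! ### Counting predecessors in a finite set -/

open Classical in
/-- The number of elements of `E` that precede `i` in the relation `r`. -/
noncomputable def countBefore (r : ℕ → ℕ → Prop) (E : Finset ℕ) (i : ℕ) : ℕ :=
  (E.filter fun k => r k i).card

section countBefore

variable {r : ℕ → ℕ → Prop} {E : Finset ℕ}

theorem countBefore_lt_card (irr : ∀ i, ¬ r i i) {i : ℕ} (hi : i ∈ E) :
    countBefore r E i < E.card := by
  classical
  refine Finset.card_lt_card (Finset.filter_ssubset.2 ⟨i, hi, irr i⟩)

theorem countBefore_lt (irr : ∀ i, ¬ r i i) (tr : ∀ i j k, r i j → r j k → r i k) {i j : ℕ}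
    (hi : i ∈ E) (h : r i j) : countBefore r E i < countBefore r E j := by
  classical
  refine Finset.card_lt_card ⟨fun k hk => ?_, fun hs => ?_⟩
  · simp only [Finset.mem_filter] at hk ⊢
    exact ⟨hk.1, tr _ _ _ hk.2 h⟩
  · have := hs (Finset.mem_filter.2 ⟨hi, h⟩)
    exact irr i (Finset.mem_filter.1 this).2

theorem countBefore_injOn (irr : ∀ i, ¬ r i i) (tr : ∀ i j k, r i j → r j k → r i k)
    (tot : ∀ i ∈ E, ∀ j ∈ E, i ≠ j → r i j ∨ r j i) {i j : ℕ} (hi : i ∈ E) (hj : j ∈ E)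
    (h : countBefore r E i = countBefore r E j) : i = j := by
  by_contra hne
  rcases tot i hi j hj hne with h1 | h1
  · have := countBefore_lt irr tr hi h1; omega
  · have := countBefore_lt irr tr hj h1; omega

/-- The counts are distinct numbers below `E.card`, so by cardinality they are all of them. -/
theorem exists_countBefore_eq (irr : ∀ i, ¬ r i i) (tr : ∀ i j k, r i j → r j k → r i k)
    (tot : ∀ i ∈ E, ∀ j ∈ E, i ≠ j → r i j ∨ r j i) {n : ℕ} (hn : n < E.card) :
    ∃ i ∈ E, countBefore r E i = n := by
  have h1 : E.image (countBefore r E) ⊆ Finset.range E.card := by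
    intro x hx
    obtain ⟨i, hi, rfl⟩ := Finset.mem_image.1 hx
    exact Finset.mem_range.2 (countBefore_lt_card irr hi)
  have h2 : E.image (countBefore r E) = Finset.range E.card := by
    refine Finset.eq_of_subset_of_card_le h1 ?_
    rw [Finset.card_range, Finset.card_image_of_injOn]
    intro i hi j hj h
    exact countBefore_injOn irr tr tot hi hj h
  have h3 : n ∈ E.image (countBefore r E) := by rw [h2]; exact Finset.mem_range.2 hn
  simpa using h3

end countBefore

/-! ### The ideal priority queue and the slack of its packets -/

/-- The packets in `C` together with the packet arriving in slot `t`. -/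
def withArrival {α : Type} (input : ℕ → SlotInput α) (t : ℕ) (C : Finset ℕ) : Finset ℕ :=
  if (input t).arrival.isSome then insert t C else C

theorem mem_withArrival {α : Type} {input : ℕ → SlotInput α} {t i : ℕ} {C : Finset ℕ} :
    i ∈ withArrival input t C ↔ i ∈ C ∨ i = t ∧ (input t).arrival.isSome := by
  unfold withArrival
  split_ifs with h <;> simp [h, or_comm]

section ideal

variable {α : Type} [LinearOrder α]

/-- Packet `k` has a higher priority than packet `i`. -/
def Beats (input : ℕ → SlotInput α) (k i : ℕ) : Prop :=
  ∃ x y : α, (input k).arrival = some x ∧ (input i).arrival = some y ∧ y < x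

theorem Beats.irrefl {input : ℕ → SlotInput α} (i : ℕ) : ¬ Beats input i i := by
  rintro ⟨x, y, h1, h2, h⟩
  rw [h1] at h2
  obtain rfl : x = y := by simpa using h2
  exact lt_irrefl _ h

theorem Beats.trans {input : ℕ → SlotInput α} (i j k : ℕ) (h1 : Beats input i j)
    (h2 : Beats input j k) : Beats input i k := by
  obtain ⟨x, y, hx, hy, h⟩ := h1
  obtain ⟨y', z, hy', hz, h'⟩ := h2
  rw [hy] at hy'
  obtain rfl : y = y' := by simpa using hy'
  exact ⟨x, z, hx, hz, h'.trans h⟩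

theorem Beats.total {input : ℕ → SlotInput α} (hin : DistinctPriorities input) {i j : ℕ}
    (hi : (input i).arrival.isSome) (hj : (input j).arrival.isSome) (h : i ≠ j) :
    Beats input i j ∨ Beats input j i := by
  obtain ⟨x, hx⟩ := Option.isSome_iff_exists.1 hi
  obtain ⟨y, hy⟩ := Option.isSome_iff_exists.1 hj
  rcases lt_trichotomy x y with h1 | h1 | h1
  · exact Or.inr ⟨y, x, hy, hx, h1⟩
  · subst h1; exact absurd (hin _ _ _ hx hy) h
  · exact Or.inl ⟨x, y, hx, hy, h1⟩

open Classical in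
/-- The element of `P`, if any, that is preceded by exactly `n` elements in priority. -/
noncomputable def ranked (input : ℕ → SlotInput α) (P : Finset ℕ) (n : ℕ) : Option ℕ :=
  (P.filter fun i => countBefore (Beats input) P i = n).toList.head?

theorem ranked_eq_some {input : ℕ → SlotInput α} {P : Finset ℕ} {n i : ℕ}
    (h : ranked input P n = some i) : i ∈ P ∧ countBefore (Beats input) P i = n := by
  simpa using List.mem_of_head? h

/-- The packet departing from a priority queue in slot `t` if the packets in `P` are present. -/
noncomputable def departing (input : ℕ → SlotInput α) (t : ℕ) (P : Finset ℕ) : Option ℕ :=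
  if (input t).request then ranked input P 0 else none

/-- The packet lost by a priority queue with buffer `B` in slot `t` if the packets in `P` are
present. -/
noncomputable def losing (input : ℕ → SlotInput α) (B t : ℕ) (P : Finset ℕ) : Option ℕ :=
  if (input t).request then none else ranked input P B

/-- The content of a priority queue with buffer `B` just before slot `t`. -/
noncomputable def content (input : ℕ → SlotInput α) (B : ℕ) : ℕ → Finset ℕ
  | 0 => ∅
  | t + 1 =>
    withArrival input t (content input B t) \
      ((departing input t (withArrival input t (content input B t))).toFinset ∪
        (losing input B t (withArrival input t (content input B t))).toFinset)

/-- The packets present in a priority queue with buffer `B` in slot `t`. -/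
noncomputable def population (input : ℕ → SlotInput α) (B t : ℕ) : Finset ℕ :=
  withArrival input t (content input B t)

/-- The trace of a priority queue with buffer `B`. -/
noncomputable def idealTrace (input : ℕ → SlotInput α) (B : ℕ) : QueueTrace where
  stored := content input B
  departure t := departing input t (population input B t)
  loss t := losing input B t (population input B t)

open Classical in
/-- A lower bound for the number of slots that pass before packet `i`, present in slot `t`,
can leave a priority queue with buffer `B`. -/
noncomputable def slack (input : ℕ → SlotInput α) (B t i : ℕ) : ℕ :=
  if i ∈ population input B t then
    min (countBefore (Beats input) (population input B t) i)
      (B - countBefore (Beats input) (population input B t) i)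
  else 0

theorem content_succ (input : ℕ → SlotInput α) (B t : ℕ) : content input B (t + 1) =
    population input B t \ ((departing input t (population input B t)).toFinset ∪
      (losing input B t (population input B t)).toFinset) := rfl

variable {input : ℕ → SlotInput α} {B : ℕ}

theorem mem_content_succ {t i : ℕ} : i ∈ content input B (t + 1) ↔ i ∈ population input B t ∧
    departing input t (population input B t) ≠ some i ∧
    losing input B t (population input B t) ≠ some i := by
  rw [content_succ]
  simp

theorem mem_population {t i : ℕ} : i ∈ population input B t ↔
    i ∈ content input B t ∨ i = t ∧ (input t).arrival.isSome := mem_withArrival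

theorem lt_of_mem_content {t i : ℕ} (h : i ∈ content input B t) :
    i < t ∧ (input i).arrival.isSome := by
  induction t with
  | zero => simp [content] at h
  | succ t ih =>
    rcases mem_population.1 (mem_content_succ.1 h).1 with h1 | ⟨rfl, h1⟩
    · exact ⟨by have := (ih h1).1; omega, (ih h1).2⟩
    · exact ⟨by omega, h1⟩

theorem isSome_of_mem_population {t i : ℕ} (h : i ∈ population input B t) :
    (input i).arrival.isSome := by
  rcases mem_population.1 h with h1 | ⟨rfl, h1⟩
  · exact (lt_of_mem_content h1).2
  · exact h1

theorem le_of_mem_population {t i : ℕ} (h : i ∈ population input B t) : i ≤ t := by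
  rcases mem_population.1 h with h1 | ⟨rfl, h1⟩
  · exact (lt_of_mem_content h1).1.le
  · exact le_rfl

theorem departing_eq_some {t i : ℕ} (h : departing input t (population input B t) = some i) :
    (input t).request = true ∧ i ∈ population input B t ∧
      countBefore (Beats input) (population input B t) i = 0 := by
  unfold departing at h
  split_ifs at h with h1
  exact ⟨h1, ranked_eq_some h⟩

theorem losing_eq_some {t i : ℕ} (h : losing input B t (population input B t) = some i) :
    ¬ (input t).request = true ∧ i ∈ population input B t ∧
      countBefore (Beats input) (population input B t) i = B := by
  unfold losing at h
  split_ifs at h with h1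
  exact ⟨h1, ranked_eq_some h⟩

theorem isSome_ranked_iff (hin : DistinctPriorities input) {t n : ℕ} :
    (ranked input (population input B t) n).isSome ↔ n < (population input B t).card := by
  constructor
  · intro h
    obtain ⟨i, hi⟩ := Option.isSome_iff_exists.1 h
    obtain ⟨h1, rfl⟩ := ranked_eq_some hi
    exact countBefore_lt_card Beats.irrefl h1
  · intro h
    obtain ⟨i, hi, h1⟩ := exists_countBefore_eq Beats.irrefl Beats.trans
      (fun i hi j hj hne => Beats.total hin (isSome_of_mem_population hi)
        (isSome_of_mem_population hj) hne) h
    rw [ranked, List.isSome_head?]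
    exact List.ne_nil_of_mem (a := i) (by simp [hi, h1])

theorem card_population (t : ℕ) : (population input B t).card =
    (content input B t).card + linkState (input t).arrival := by
  unfold population withArrival linkState
  split_ifs with h
  · rw [Finset.card_insert_of_notMem]
    intro h1
    have := (lt_of_mem_content h1).1
    omega
  · rfl

theorem card_toFinset_eq_linkState (o : Option ℕ) : o.toFinset.card = linkState o := by
  cases o <;> simp [linkState]

theorem linkState_departing (hin : DistinctPriorities input) (t : ℕ) :
    linkState (departing input t (population input B t)) =
      if (input t).request = true ∧ 0 < (population input B t).card then 1 else 0 := by
  unfold linkState departing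
  by_cases h : (input t).request = true
  · simp [h, isSome_ranked_iff hin]
  · simp [h]

theorem linkState_losing (hin : DistinctPriorities input) (t : ℕ) :
    linkState (losing input B t (population input B t)) =
      if (input t).request = false ∧ B < (population input B t).card then 1 else 0 := by
  unfold linkState losing
  by_cases h : (input t).request = true
  · simp [h]
  · simp [h, isSome_ranked_iff hin]

theorem departing_ne_losing {t i : ℕ}
    (h : departing input t (population input B t) = some i) :
    losing input B t (population input B t) ≠ some i := fun h' =>
  (losing_eq_some h').1 (departing_eq_some h).1

theorem card_content_succ (t : ℕ) : (content input B (t + 1)).card +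
    linkState (departing input t (population input B t)) +
    linkState (losing input B t (population input B t)) = (population input B t).card := by
  rw [content_succ, ← card_toFinset_eq_linkState, ← card_toFinset_eq_linkState, add_assoc,
    ← Finset.card_union_of_disjoint, Finset.card_sdiff_add_card_eq_card]
  · intro i hi
    rcases Finset.mem_union.1 hi with h | h
    · exact (departing_eq_some (by simpa using h)).2.1
    · exact (losing_eq_some (by simpa using h)).2.1
  · rw [Finset.disjoint_left]
    intro i h1 h2
    exact departing_ne_losing (by simpa using h1) (by simpa using h2)

theorem linkState_le_one {β : Type} (o : Option β) : linkState o ≤ 1 := by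
  unfold linkState; split_ifs <;> omega

theorem card_content_le (hin : DistinctPriorities input) (t : ℕ) :
    (content input B t).card ≤ B := by
  induction t with
  | zero => simp [content]
  | succ t ih =>
    have h1 := card_content_succ (input := input) (B := B) t
    have h2 := card_population (input := input) (B := B) t
    have h3 := linkState_le_one (input t).arrival
    rw [linkState_departing hin, linkState_losing hin] at h1
    cases hr : (input t).request <;> simp only [hr, reduceCtorEq, true_and, false_and, if_false]
      at h1 <;> split_ifs at h1 <;> omega

theorem idealTrace_isPriorityQueue (hin : DistinctPriorities input) :
    (idealTrace input B).IsPriorityQueue input B where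
  initially_empty := rfl
  flow t := by
    show content input B (t + 1) ∪ (departing input t (population input B t)).toFinset ∪
      (losing input B t (population input B t)).toFinset = population input B t
    rw [content_succ, Finset.union_assoc, Finset.sdiff_union_of_subset]
    intro i hi
    rcases Finset.mem_union.1 hi with h | h
    · exact (departing_eq_some (by simpa using h)).2.1
    · exact (losing_eq_some (by simpa using h)).2.1
  flow_conservation t := by
    show ((content input B (t + 1)).card : ℤ) = (content input B t).card + _ -
      linkState (departing input t (population input B t)) -
      linkState (losing input B t (population input B t))
    have h1 := card_content_succ (input := input) (B := B) t
    have h2 := card_population (input := input) (B := B) t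
    omega
  non_idling t := by
    show linkState (departing input t (population input B t)) =
      if _ ∧ 0 < (content input B t).card + _ then 1 else 0
    rw [linkState_departing hin, card_population]
    congr
  loss_iff_full t := by
    show linkState (losing input B t (population input B t)) =
      if _ ∧ (content input B t).card = B ∧ _ then 1 else 0
    rw [linkState_losing hin, card_population]
    have h1 := card_content_le (B := B) hin t
    have h3 := linkState_le_one (input t).arrival
    refine if_congr (and_congr_right fun _ => ?_) rfl rfl
    omega
  loss_eq_excess t := by
    show (linkState (losing input B t (population input B t)) : ℤ) =
      max ((content input B t).card + _ - linkState (departing input t (population input B t)) - B) 0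
    rw [linkState_departing hin, linkState_losing hin]
    have h1 := card_content_le (B := B) hin t
    have h2 := card_population (input := input) (B := B) t
    have h3 := linkState_le_one (input t).arrival
    cases hr : (input t).request <;> simp only [reduceCtorEq, true_and, false_and, if_false] <;>
      split_ifs <;> push_cast <;> omega
  priority_departure t i h := by
    obtain ⟨-, h1, h2⟩ := departing_eq_some h
    exact ⟨h1, congrArg (· + 1) h2⟩
  priority_loss t i h := by
    obtain ⟨-, h1, h2⟩ := losing_eq_some h
    exact ⟨h1, congrArg (· + 1) h2⟩

theorem countBefore_le_of_subset_insert {r : ℕ → ℕ → Prop} {P P' : Finset ℕ} {a : ℕ}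
    (h : P ⊆ insert a P') (i : ℕ) : countBefore r P i ≤ countBefore r P' i + 1 := by
  classical
  refine le_trans (Finset.card_le_card (t := insert a (P'.filter fun k => r k i)) ?_)
    (Finset.card_insert_le _ _)
  intro k hk
  simp only [Finset.mem_filter, Finset.mem_insert] at hk ⊢
  rcases Finset.mem_insert.1 (h hk.1) with h1 | h1
  · exact Or.inl h1
  · exact Or.inr ⟨h1, hk.2⟩

theorem population_succ_subset (t : ℕ) :
    population input B (t + 1) ⊆ insert (t + 1) (population input B t) := by
  intro i hi
  rcases mem_population.1 hi with h | ⟨h, -⟩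
  · exact Finset.mem_insert_of_mem (mem_content_succ.1 h).1
  · exact Finset.mem_insert.2 (Or.inl h)

/-- A departure needs a request and a loss needs its absence, so at most one packet is removed per
slot. -/
theorem exists_population_subset (t : ℕ) :
    ∃ a, population input B t ⊆ insert a (population input B (t + 1)) := by
  by_cases hr : (input t).request = true
  -- If nothing departs, the default 0 is harmless: inserting an extra element only weakens the
  -- inclusion.
  · refine ⟨(departing input t (population input B t)).getD 0, fun i hi => ?_⟩
    by_cases h : departing input t (population input B t) = some i
    · simp [h]
    · exact Finset.mem_insert_of_mem (mem_population.2 (Or.inl (mem_content_succ.2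
        ⟨hi, h, fun h' => (losing_eq_some h').1 hr⟩)))
  · refine ⟨(losing input B t (population input B t)).getD 0, fun i hi => ?_⟩
    by_cases h : losing input B t (population input B t) = some i
    · simp [h]
    · exact Finset.mem_insert_of_mem (mem_population.2 (Or.inl (mem_content_succ.2
        ⟨hi, fun h' => hr (departing_eq_some h').1, h⟩)))

/-- Between consecutive populations at most one packet is gained and at most one lost, so the number
of packets ahead of `i` moves by at most 1, and so does its distance to `B`. -/
theorem slack_lipschitz {t i : ℕ} (hi : i ∈ content input B (t + 1)) :
    slack input B (t + 1) i ≤ slack input B t i + 1 ∧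
      slack input B t i ≤ slack input B (t + 1) i + 1 := by
  have h1 : i ∈ population input B t := (mem_content_succ.1 hi).1
  have h2 : i ∈ population input B (t + 1) := mem_population.2 (Or.inl hi)
  obtain ⟨a, ha⟩ := exists_population_subset (input := input) (B := B) t
  have h3 := countBefore_le_of_subset_insert (r := Beats input) ha i
  have h4 := countBefore_le_of_subset_insert (r := Beats input)
    (population_succ_subset (input := input) (B := B) t) i
  simp only [slack, h1, h2, if_true]
  omega

theorem slack_eq_zero {t i : ℕ} (hi : departing input t (population input B t) = some i ∨
    losing input B t (population input B t) = some i) : slack input B t i = 0 := by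
  rcases hi with h | h
  · obtain ⟨-, h1, h2⟩ := departing_eq_some h
    simp [slack, h1, h2]
  · obtain ⟨-, h1, h2⟩ := losing_eq_some h
    simp [slack, h1, h2]

theorem two_mul_slack_le (t i : ℕ) : 2 * slack input B t i ≤ B := by
  unfold slack
  split_ifs <;> omega

/-- Packets have distinct predecessor counts, and each slack value is attained by at most two
counts: one near the head of the queue and its mirror image near `B`. -/
theorem card_slack_le (hin : DistinctPriorities input) (t a n : ℕ) :
    ((population input B t).filter fun i =>
      a ≤ slack input B t i ∧ slack input B t i < a + n).card ≤ 2 * n := by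
  have hcard : (Finset.Ico a (a + n) ∪ Finset.Ico (B + 1 - a - n) (B + 1 - a)).card ≤ 2 * n := by
    refine (Finset.card_union_le _ _).trans ?_
    simp only [Nat.card_Ico]
    omega
  refine le_trans (Finset.card_le_card_of_injOn
    (countBefore (Beats input) (population input B t)) ?_ ?_) hcard
  · intro i hi
    simp only [Finset.coe_filter, Set.mem_ofPred_eq] at hi
    obtain ⟨hp, h1, h2⟩ := hi
    have h3 := countBefore_lt_card (r := Beats input) Beats.irrefl hp
    have h4 := card_population (input := input) (B := B) t
    have h5 := card_content_le (B := B) hin t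
    have h6 := linkState_le_one (input t).arrival
    simp only [slack, hp, if_true] at h1 h2
    simp only [Finset.coe_union, Finset.coe_Ico, Set.mem_union, Set.mem_Ico]
    omega
  · intro i hi j hj h
    simp only [Finset.coe_filter, Set.mem_ofPred_eq] at hi hj
    exact countBefore_injOn Beats.irrefl Beats.trans (fun i hi j hj hne => Beats.total hin
      (isSome_of_mem_population hi) (isSome_of_mem_population hj) hne) hi.1 hj.1 h

theorem countBefore_congr {r r' : ℕ → ℕ → Prop} {E : Finset ℕ} {i : ℕ} (hi : i ∈ E)
    (h : ∀ k ∈ E, ∀ l ∈ E, (r k l ↔ r' k l)) : countBefore r E i = countBefore r' E i := by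
  classical
  exact congrArg Finset.card (Finset.filter_congr fun k hk => h k hk i hi)

theorem ranked_congr {input' : ℕ → SlotInput α} {P : Finset ℕ}
    (h : ∀ i ∈ P, input i = input' i) (n : ℕ) : ranked input P n = ranked input' P n := by
  have h1 : ∀ i ∈ P, countBefore (Beats input) P i = countBefore (Beats input') P i :=
    fun i hi => countBefore_congr hi fun k hk l hl => by simp only [Beats, h k hk, h l hl]
  unfold ranked
  rw [Finset.filter_congr fun i hi => by rw [h1 i hi]]

theorem departing_losing_congr {input' : ℕ → SlotInput α} {t : ℕ}
    (h : ∀ s ≤ t, input s = input' s) :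
    departing input t (population input B t) = departing input' t (population input B t) ∧
    losing input B t (population input B t) = losing input' B t (population input B t) := by
  have h1 : ∀ n, ranked input (population input B t) n = ranked input' (population input B t) n :=
    ranked_congr fun i hi => h i (le_of_mem_population hi)
  simp only [departing, losing, h1, h t le_rfl, and_self]

/-- This and the neighbouring congruences express the causality needed for `exists_controller`. -/
theorem content_congr {input' : ℕ → SlotInput α} {t : ℕ} (h : ∀ s < t, input s = input' s) :
    content input B t = content input' B t := by
  induction t with
  | zero => rfl
  | succ t ih =>
    have h1 : population input B t = population input' B t := by
      unfold population withArrival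
      rw [ih fun s hs => h s (by omega), h t (by omega)]
    have h2 := departing_losing_congr (B := B) (t := t) fun s hs => h s (by omega)
    rw [content_succ, content_succ, h2.1, h2.2, h1]

theorem population_congr {input' : ℕ → SlotInput α} {t : ℕ} (h : ∀ s ≤ t, input s = input' s) :
    population input B t = population input' B t := by
  unfold population withArrival
  rw [content_congr fun s hs => h s hs.le, h t le_rfl]

theorem idealTrace_congr {input' : ℕ → SlotInput α} {t : ℕ} (h : ∀ s ≤ t, input s = input' s) :
    (idealTrace input B).departure t = (idealTrace input' B).departure t ∧
    (idealTrace input B).loss t = (idealTrace input' B).loss t := by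
  have h2 := departing_losing_congr (B := B) h
  simpa only [idealTrace, ← population_congr h] using h2

theorem slack_congr {input' : ℕ → SlotInput α} {t : ℕ} (h : ∀ s ≤ t, input s = input' s) :
    slack input B t = slack input' B t := by
  funext i
  unfold slack
  rw [← population_congr h]
  split_ifs with hi
  · rw [countBefore_congr hi (r' := Beats input') fun k hk l hl => by
      simp only [Beats, h k (le_of_mem_population hk), h l (le_of_mem_population hl)]]
  · rfl

end ideal

/-! ### Slack processes, multiplexers and tickets -/

/-- The packets present in each slot `t` (`P t`), those stored just before slot `t` (`C t`), and
for every packet present a lower bound `σ t i` for the number of slots before it is removed. -/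
structure SlackProcess (P C : ℕ → Finset ℕ) (σ : ℕ → ℕ → ℕ) : Prop where
  zero : C 0 = ∅
  content_succ_subset : ∀ t, C (t + 1) ⊆ P t
  subset_insert : ∀ t, P t ⊆ insert t (C t)
  content_subset : ∀ t, C t ⊆ P t
  lt : ∀ t, ∀ i ∈ C t, i < t
  lipschitz : ∀ t, ∀ i ∈ C (t + 1), σ (t + 1) i ≤ σ t i + 1 ∧ σ t i ≤ σ (t + 1) i + 1
  card_le : ∀ t a n, ((P t).filter fun i => a ≤ σ t i ∧ σ t i < a + n).card ≤ 2 * n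
  removed : ∀ t, ∀ i ∈ P t, i ∉ C (t + 1) → σ t i = 0

/-- The assignment of a stored packet to the multiplexer `level`. The packet
entered it in slot `enter`, last entered a delay line in slot `hop`, and will leave the multiplexer
in slot `number / 8` on its output `number % 8`. -/
structure Ticket where
  level : ℕ
  enter : ℕ
  number : ℕ
  hop : ℕ

namespace Ticket

/-- The slot in which a packet leaves its multiplexer. -/
def exit (R : Ticket) : ℕ := R.number / 8

/-- A packet that has to be delayed by `y` enters a line whose delay is the largest power of `2`
dividing `y`. -/
def stage (R : Ticket) : ℕ := padicValNat 2 (R.exit - R.hop)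

/-- Move a packet to its next delay line if it reaches the end of the current one in slot `t`. -/
def advance (R : Ticket) (t : ℕ) : Ticket :=
  if R.hop + 2 ^ R.stage = t then { R with hop := t } else R

theorem advance_level (R : Ticket) (t : ℕ) : (R.advance t).level = R.level := by
  unfold advance; split_ifs <;> rfl

theorem advance_enter (R : Ticket) (t : ℕ) : (R.advance t).enter = R.enter := by
  unfold advance; split_ifs <;> rfl

theorem advance_number (R : Ticket) (t : ℕ) : (R.advance t).number = R.number := by
  unfold advance; split_ifs <;> rfl

theorem advance_exit (R : Ticket) (t : ℕ) : (R.advance t).exit = R.exit := by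
  unfold exit; rw [advance_number]

end Ticket

/-- The tickets of the stored packets, and for each multiplexer the next ticket number. -/
structure Board where
  ticket : ℕ → Option Ticket
  next : ℕ → ℕ

/-- The multiplexer for packets of slack `s`. -/
def slackLevel (s : ℕ) : ℕ := Nat.log 2 (s / 2)

theorem lt_of_slackLevel (s : ℕ) : s < 4 * 2 ^ slackLevel s := by
  have := Nat.lt_pow_succ_log_self (b := 2) (by norm_num) (s / 2)
  rw [pow_succ] at this
  unfold slackLevel
  omega

theorem le_of_slackLevel (s : ℕ) : 2 * 2 ^ slackLevel s ≤ s ∨ slackLevel s = 0 := by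
  by_cases h : s / 2 = 0
  · right; simp [slackLevel, h]
  · have := Nat.pow_log_le_self 2 h
    unfold slackLevel
    omega

theorem exists_eq_two_pow_mul {y : ℕ} (hy : y ≠ 0) :
    ∃ q, y = 2 ^ (padicValNat 2 y + 1) * q + 2 ^ padicValNat 2 y := by
  obtain ⟨c, hc⟩ := (pow_padicValNat_dvd : 2 ^ padicValNat 2 y ∣ y)
  have hodd : ¬ 2 ∣ c := by
    rintro ⟨d, rfl⟩
    exact pow_succ_padicValNat_not_dvd (p := 2) hy ⟨d, by rw [pow_succ, mul_assoc]; exact hc⟩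
  refine ⟨c / 2, ?_⟩
  have h2 : c = 2 * (c / 2) + 1 := by omega
  calc y = 2 ^ padicValNat 2 y * (2 * (c / 2) + 1) := by rw [← h2]; exact hc
    _ = _ := by ring

/-- Clearing the lowest binary digit 1 leaves a multiple of the next power of 2. Hence a packet runs
through strictly increasing stages inside a multiplexer. -/
theorem lt_padicValNat_sub {y : ℕ} (hy : y ≠ 0) (h : y - 2 ^ padicValNat 2 y ≠ 0) :
    padicValNat 2 y < padicValNat 2 (y - 2 ^ padicValNat 2 y) := by
  obtain ⟨q, hq⟩ := exists_eq_two_pow_mul hy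
  refine (padicValNat_dvd_iff_le h).1 ⟨q, ?_⟩
  exact Nat.sub_eq_of_eq_add hq

open Classical in
/-- The stored packets that are assigned to a multiplexer in slot `t`. -/
noncomputable def deciding (b : Board) (t : ℕ) (C' : Finset ℕ) : Finset ℕ :=
  C'.filter fun i => ∀ R, b.ticket i = some R → R.exit = t

/-- The packets that enter multiplexer `j` in slot `t`. -/
noncomputable def entering (b : Board) (t : ℕ) (C' : Finset ℕ) (s : ℕ → ℕ) (j : ℕ) : Finset ℕ :=
  (deciding b t C').filter fun i => slackLevel (s i) = j

/-- The first ticket number used for multiplexer `j` in slot `t`. -/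
def Board.base (b : Board) (t j : ℕ) : ℕ := max (b.next j) (8 * (t + 1))

open Classical in
/-- The board after slot `t`, in which the packets in `C'` remain stored. -/
noncomputable def Board.step (b : Board) (t : ℕ) (C' : Finset ℕ) (s : ℕ → ℕ) : Board where
  ticket i :=
    if i ∈ C' then
      if i ∈ deciding b t C' then
        some ⟨slackLevel (s i), t, b.base t (slackLevel (s i)) +
          countBefore (· < ·) (entering b t C' s (slackLevel (s i))) i, t⟩
      else (b.ticket i).map fun R => R.advance t
    else none
  next j := b.base t j + (entering b t C' s j).card

/-- The board just before slot `t`. -/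
noncomputable def board (C : ℕ → Finset ℕ) (σ : ℕ → ℕ → ℕ) : ℕ → Board
  | 0 => ⟨fun _ => none, fun _ => 0⟩
  | t + 1 => (board C σ t).step t (C (t + 1)) (σ t)

theorem board_congr {C C' : ℕ → Finset ℕ} {σ σ' : ℕ → ℕ → ℕ} {t : ℕ}
    (hC : ∀ s ≤ t, C s = C' s) (hσ : ∀ s < t, σ s = σ' s) : board C σ t = board C' σ' t := by
  induction t with
  | zero => rfl
  | succ t ih =>
    rw [board, board, ih (fun s hs => hC s (by omega)) (fun s hs => hσ s (by omega)),
      hC _ le_rfl, hσ t (by omega)]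

/-! ### Invariants of the multiplexers -/

/-- The properties of the tickets just before slot `t`. -/
structure BoardInvariant (C : ℕ → Finset ℕ) (σ : ℕ → ℕ → ℕ) (t : ℕ) (b : Board) : Prop where
  mem_iff : ∀ i, i ∈ C t ↔ ∃ R, b.ticket i = some R
  enter_le_hop : ∀ i R, b.ticket i = some R → R.enter ≤ R.hop
  hop_lt : ∀ i R, b.ticket i = some R → R.hop < t
  le_hop_add : ∀ i R, b.ticket i = some R → t ≤ R.hop + 2 ^ R.stage
  hop_lt_exit : ∀ i R, b.ticket i = some R → R.hop < R.exit
  hop_lt_add : ∀ i R, b.ticket i = some R → R.hop < R.enter + 2 ^ R.stage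
  level_eq : ∀ i R, b.ticket i = some R → R.level = slackLevel (σ R.enter i)
  slack_le : ∀ i R, b.ticket i = some R →
    σ t i ≤ σ R.enter i + (t - R.enter) ∧ σ R.enter i ≤ σ t i + (t - R.enter)
  exit_le : ∀ i R, b.ticket i = some R → R.exit ≤ R.enter + 2 ^ R.level
  lt_next : ∀ i R, b.ticket i = some R → R.number < b.next R.level
  next_le : ∀ i R, b.ticket i = some R → b.next R.level ≤ R.number + 25 * (t - R.enter)
  unique : ∀ i i' R R', b.ticket i = some R → b.ticket i' = some R' → R.level = R'.level →
    R.number = R'.number → i = i'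
  held : ∀ j v, 8 * t ≤ v → v < b.next j → ∃ i R, b.ticket i = some R ∧ R.level = j ∧ R.number = v
  fifo : ∀ i i' R R', b.ticket i = some R → b.ticket i' = some R' → R.level = R'.level →
    R.number < R'.number → R.enter ≤ R'.enter ∧ R'.number < R.number + 25 * (R'.enter + 1 - R.enter)

theorem two_pow_stage_le {R : Ticket} (h : R.hop < R.exit) : R.hop + 2 ^ R.stage ≤ R.exit := by
  have : 2 ^ R.stage ≤ R.exit - R.hop :=
    Nat.le_of_dvd (by omega) pow_padicValNat_dvd
  omega

namespace BoardInvariant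

variable {P C : ℕ → Finset ℕ} {σ : ℕ → ℕ → ℕ} {t : ℕ} {b : Board}

theorem le_exit (h : BoardInvariant C σ t b) {i : ℕ} {R : Ticket} (hR : b.ticket i = some R) :
    t ≤ R.exit :=
  (h.le_hop_add i R hR).trans (two_pow_stage_le (h.hop_lt_exit i R hR))

/-- A packet without slack is at an output of its multiplexer. -/
theorem exit_eq_of_slack_eq_zero (h : BoardInvariant C σ t b) {i : ℕ} {R : Ticket}
    (hR : b.ticket i = some R) (hs : σ t i = 0) : R.exit = t := by
  have h1 := h.le_exit hR
  have h2 := h.exit_le i R hR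
  have h3 := (h.slack_le i R hR).2
  have h4 := h.enter_le_hop i R hR
  have h5 := h.hop_lt i R hR
  have h6 := le_of_slackLevel (σ R.enter i)
  rw [← h.level_eq i R hR] at h6
  have h7 : 0 < 2 ^ R.level := by positivity
  rcases h6 with h6 | h6
  · omega
  · rw [h6] at h2; simp only [pow_zero] at h2; omega

theorem mem_deciding (hp : SlackProcess P C σ) (h : BoardInvariant C σ t b) {i : ℕ}
    (hi : i ∈ deciding b t (C (t + 1))) :
    i ∈ C (t + 1) ∧ (i = t ∨ ∃ R, b.ticket i = some R ∧ R.exit = t) := by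
  classical
  obtain ⟨h1, h2⟩ := Finset.mem_filter.1 hi
  refine ⟨h1, ?_⟩
  rcases Finset.mem_insert.1 (hp.subset_insert t (hp.content_succ_subset t h1)) with h3 | h3
  · exact Or.inl h3
  · obtain ⟨R, hR⟩ := (h.mem_iff i).1 h3
    exact Or.inr ⟨R, hR, h2 R hR⟩

/-- A packet moves only between neighbouring multiplexers. -/
theorem level_mem_Icc (h : BoardInvariant C σ t b) {i : ℕ} {R : Ticket}
    (hR : b.ticket i = some R) (he : R.exit = t) :
    R.level ≤ slackLevel (σ t i) + 1 ∧ slackLevel (σ t i) ≤ R.level + 1 := by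
  have h2 := h.exit_le i R hR
  obtain ⟨h3, h4⟩ := h.slack_le i R hR
  have h6 := le_of_slackLevel (σ R.enter i)
  have h7 := lt_of_slackLevel (σ R.enter i)
  rw [← h.level_eq i R hR] at h6 h7
  have h8 := le_of_slackLevel (σ t i)
  have h9 := lt_of_slackLevel (σ t i)
  constructor
  · rcases h6 with h6 | h6
    · have : 2 ^ R.level < 2 ^ (slackLevel (σ t i) + 2) := by
        rw [pow_add]; omega
      have := (Nat.pow_lt_pow_iff_right (by norm_num : 1 < 2)).1 this
      omega
    · omega
  · rcases h8 with h8 | h8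
    · have : 2 ^ slackLevel (σ t i) < 2 ^ (R.level + 2) := by
        rw [pow_add]
        have h10 : 0 < 2 ^ R.level := by positivity
        omega
      have := (Nat.pow_lt_pow_iff_right (by norm_num : 1 < 2)).1 this
      omega
    · omega

/-- Apart from the packet arriving in slot `t`, those entering come from the 8 outputs of at most
three multiplexers, whence `3 * 8 + 1`. -/
theorem card_entering_le (hp : SlackProcess P C σ) (h : BoardInvariant C σ t b) (j : ℕ) :
    (entering b t (C (t + 1)) (σ t) j).card ≤ 25 := by
  classical
  have key : ∀ i ∈ (entering b t (C (t + 1)) (σ t) j).erase t,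
      ∃ R, b.ticket i = some R ∧ R.exit = t ∧ R.level ≤ j + 1 ∧ j ≤ R.level + 1 := by
    intro i hi
    obtain ⟨h1, h2⟩ := Finset.mem_erase.1 hi
    obtain ⟨h3, rfl⟩ := Finset.mem_filter.1 h2
    rcases (h.mem_deciding hp h3).2 with h4 | ⟨R, hR, he⟩
    · exact absurd h4 h1
    · exact ⟨R, hR, he, h.level_mem_Icc hR he⟩
  have h1 : ((entering b t (C (t + 1)) (σ t) j).erase t).card ≤
      (Finset.Icc (j - 1) (j + 1) ×ˢ Finset.range 8).card := by
    -- Level and output identify the packet: the exit slot is `t`, so the number is `8 * t` plus its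
    -- residue modulo 8.
    refine Finset.card_le_card_of_injOn
      (fun i => (((b.ticket i).map Ticket.level).getD 0, ((b.ticket i).map Ticket.number).getD 0 % 8))
      ?_ ?_
    · intro i hi
      obtain ⟨R, hR, he, h2, h3⟩ := key i hi
      simp only [hR, Option.map_some, Option.getD_some, Finset.coe_product, Set.mem_prod,
        Finset.coe_Icc, Set.mem_Icc, Finset.coe_range, Set.mem_Iio]
      omega
    · intro i hi i' hi' heq
      obtain ⟨R, hR, he, -⟩ := key i hi
      obtain ⟨R', hR', he', -⟩ := key i' hi'
      simp only [hR, hR', Option.map_some, Option.getD_some, Prod.mk.injEq] at heq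
      refine h.unique i i' R R' hR hR' heq.1 ?_
      unfold Ticket.exit at he he'
      omega
  rw [Finset.card_product, Nat.card_Icc, Finset.card_range] at h1
  have h2 := Finset.pred_card_le_card_erase (s := entering b t (C (t + 1)) (σ t) j) (a := t)
  have h3 : (j + 1 + 1 - (j - 1)) * 8 ≤ 3 * 8 := Nat.mul_le_mul_right _ (by omega)
  omega

end BoardInvariant

namespace Board

variable {b : Board} {t : ℕ} {C' : Finset ℕ} {s : ℕ → ℕ}

/-- A packet that is on the board after a slot either entered a multiplexer in this slot or
stayed in its multiplexer. -/
theorem step_cases {i : ℕ} {R : Ticket} (h : (b.step t C' s).ticket i = some R) :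
    i ∈ C' ∧
    ((i ∈ entering b t C' s R.level ∧ R.level = slackLevel (s i) ∧ R.enter = t ∧ R.hop = t ∧
        R.number = b.base t R.level + countBefore (· < ·) (entering b t C' s R.level) i) ∨
      ∃ R₀, b.ticket i = some R₀ ∧ R₀.exit ≠ t ∧ R = R₀.advance t) := by
  classical
  simp only [step] at h
  split_ifs at h with h1 h2
  · refine ⟨h1, Or.inl ?_⟩
    obtain rfl := (Option.some.inj h).symm
    exact ⟨Finset.mem_filter.2 ⟨h2, rfl⟩, rfl, rfl, rfl, rfl⟩
  · refine ⟨h1, Or.inr ?_⟩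
    obtain ⟨R₀, h3, h4⟩ := Option.map_eq_some_iff.1 h
    refine ⟨R₀, h3, fun h5 => h2 (Finset.mem_filter.2 ⟨h1, fun R' hR' => ?_⟩), h4.symm⟩
    rw [h3] at hR'
    obtain rfl := Option.some.inj hR'
    exact h5

theorem step_of_mem_entering {i j : ℕ} (h : i ∈ entering b t C' s j) :
    (b.step t C' s).ticket i =
      some ⟨j, t, b.base t j + countBefore (· < ·) (entering b t C' s j) i, t⟩ := by
  classical
  obtain ⟨h1, rfl⟩ := Finset.mem_filter.1 h
  have h2 := (Finset.mem_filter.1 h1).1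
  simp only [step, h1, h2, if_true]

theorem step_of_mem_deciding {i : ℕ} (h : i ∈ deciding b t C') :
    ∃ R, (b.step t C' s).ticket i = some R ∧ R.hop = t :=
  ⟨_, step_of_mem_entering (Finset.mem_filter.2 ⟨h, rfl⟩), rfl⟩

theorem step_of_exit_ne {i : ℕ} {R : Ticket} (hi : i ∈ C') (hR : b.ticket i = some R)
    (he : R.exit ≠ t) : (b.step t C' s).ticket i = some (R.advance t) := by
  classical
  have h1 : i ∉ deciding b t C' := fun h => he ((Finset.mem_filter.1 h).2 R hR)
  simp only [step, h1, hi, if_true, if_false, hR, Option.map_some]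

end Board

namespace BoardInvariant

variable {P C : ℕ → Finset ℕ} {σ : ℕ → ℕ → ℕ} {t : ℕ} {b : Board}

theorem zero (hC : C 0 = ∅) : BoardInvariant C σ 0 ⟨fun _ => none, fun _ => 0⟩ where
  mem_iff i := by simp [hC]
  enter_le_hop := by simp
  hop_lt := by simp
  le_hop_add := by simp
  hop_lt_exit := by simp
  hop_lt_add := by simp
  level_eq := by simp
  slack_le := by simp
  exit_le := by simp
  lt_next := by simp
  next_le := by simp
  unique := by simp
  held := by simp
  fifo := by simp

/-- At the end of a line the stage rises, so `2 ^ stage` at least doubles. This preserves the bound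
that the time spent since entry, a sum of smaller distinct powers of 2, is less than `2 ^ stage`. -/
theorem advance_transit (h : BoardInvariant C σ t b) {i : ℕ} {R : Ticket}
    (hR : b.ticket i = some R) (he : R.exit ≠ t) :
    R.enter ≤ (R.advance t).hop ∧ (R.advance t).hop < t + 1 ∧
      t + 1 ≤ (R.advance t).hop + 2 ^ (R.advance t).stage ∧ (R.advance t).hop < R.exit ∧
      (R.advance t).hop < R.enter + 2 ^ (R.advance t).stage := by
  have h1 := h.enter_le_hop i R hR
  have h2 := h.hop_lt i R hR
  have h3 := h.le_hop_add i R hR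
  have h4 := h.hop_lt_exit i R hR
  have h5 := h.hop_lt_add i R hR
  have h6 := h.le_exit hR
  by_cases h7 : R.hop + 2 ^ R.stage = t
  · have h8 : R.advance t = { R with hop := t } := if_pos h7
    have h9 : R.stage < (R.advance t).stage := by
      have e : (R.exit - R.hop) - 2 ^ R.stage = R.exit - t := by omega
      have := lt_padicValNat_sub (y := R.exit - R.hop) (by omega) (by
        change R.exit - R.hop - 2 ^ R.stage ≠ 0; omega)
      change R.stage < padicValNat 2 (R.exit - R.hop - 2 ^ R.stage) at this
      rw [e] at this
      rw [h8]; exact this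
    have h10 : 2 * 2 ^ R.stage ≤ 2 ^ (R.advance t).stage := by
      rw [← pow_succ']; exact Nat.pow_le_pow_right (by norm_num) h9
    have h11 : (R.advance t).hop = t := by rw [h8]
    rw [h11]
    have : 0 < 2 ^ R.stage := by positivity
    omega
  · have h8 : R.advance t = R := if_neg h7
    rw [h8]
    omega

theorem next_le_base (j : ℕ) : b.next j ≤ b.base t j := le_max_left _ _

theorem le_base (j : ℕ) : 8 * (t + 1) ≤ b.base t j := le_max_right _ _

/-- While a ticket for a later slot is outstanding, the numbering is already past `8 * (t + 1)`, so
it continues without a jump. -/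
theorem base_eq (h : BoardInvariant C σ t b) {i : ℕ} {R : Ticket} (hR : b.ticket i = some R)
    (he : R.exit ≠ t) : b.base t R.level = b.next R.level := by
  have h1 := h.le_exit hR
  have h2 := h.lt_next i R hR
  refine max_eq_left ?_
  unfold Ticket.exit at h1 he
  omega

theorem lt_irrefl_nat (i : ℕ) : ¬ i < i := lt_irrefl i

theorem lt_next_succ (h : BoardInvariant C σ t b) {C' : Finset ℕ} {s : ℕ → ℕ} {i : ℕ} {R : Ticket}
    (hR : (b.step t C' s).ticket i = some R) : R.number < (b.step t C' s).next R.level := by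
  show R.number < b.base t R.level + (entering b t C' s R.level).card
  rcases (Board.step_cases hR).2 with ⟨h1, -, -, -, h2⟩ | ⟨R₀, h1, h2, rfl⟩
  · have := countBefore_lt_card (r := (· < ·)) lt_irrefl_nat h1
    omega
  · rw [Ticket.advance_level, Ticket.advance_number]
    have h3 := h.lt_next i R₀ h1
    have h4 := next_le_base (t := t) (b := b) R₀.level
    omega

theorem unique_succ (h : BoardInvariant C σ t b) {C' : Finset ℕ} {s : ℕ → ℕ} {i i' : ℕ}
    {R R' : Ticket} (hR : (b.step t C' s).ticket i = some R)
    (hR' : (b.step t C' s).ticket i' = some R') (hl : R.level = R'.level)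
    (hn : R.number = R'.number) : i = i' := by
  have old : ∀ (i : ℕ) (R₀ : Ticket), b.ticket i = some R₀ →
      R₀.number < b.base t R₀.level := fun i R₀ hR₀ =>
    (h.lt_next i R₀ hR₀).trans_le (next_le_base _)
  rcases (Board.step_cases hR).2 with ⟨h1, -, -, -, h2⟩ | ⟨R₀, h1, h2, rfl⟩ <;>
    rcases (Board.step_cases hR').2 with ⟨h1', -, -, -, h2'⟩ | ⟨R₀', h1', h2', rfl⟩
  · rw [← hl] at h1' h2'
    exact countBefore_injOn (r := (· < ·)) lt_irrefl_nat (fun _ _ _ => lt_trans)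
      (fun _ _ _ _ hne => lt_or_gt_of_ne hne) h1 h1' (by omega)
  · have := old _ _ h1'
    rw [Ticket.advance_number] at hn
    rw [Ticket.advance_level] at hl
    rw [← hl] at this
    omega
  · have := old _ _ h1
    rw [Ticket.advance_number] at hn
    rw [Ticket.advance_level] at hl
    rw [hl] at this
    omega
  · simp only [Ticket.advance_number, Ticket.advance_level] at hn hl
    exact h.unique _ _ _ _ h1 h1' hl hn

/-- The numbers still to be served have no gaps. A packet is removed from the queue only with slack
0, hence only in its exit slot, and the packets entering receive consecutive numbers. -/
theorem held_succ (hp : SlackProcess P C σ) (h : BoardInvariant C σ t b) {j v : ℕ}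
    (hv : 8 * (t + 1) ≤ v) (hv' : v < (b.step t (C (t + 1)) (σ t)).next j) :
    ∃ i R, (b.step t (C (t + 1)) (σ t)).ticket i = some R ∧ R.level = j ∧ R.number = v := by
  change v < b.base t j + (entering b t (C (t + 1)) (σ t) j).card at hv'
  by_cases h1 : v < b.base t j
  · have h2 : v < b.next j := by
      unfold Board.base at h1
      omega
    obtain ⟨i, R, hR, hl, hn⟩ := h.held j v (by omega) h2
    have he : R.exit ≠ t := by unfold Ticket.exit; omega
    have hi : i ∈ C (t + 1) := by
      by_contra hi
      exact he (h.exit_eq_of_slack_eq_zero hR (hp.removed t i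
        (hp.content_subset t ((h.mem_iff i).2 ⟨R, hR⟩)) hi))
    exact ⟨i, _, Board.step_of_exit_ne hi hR he, by rw [Ticket.advance_level, hl],
      by rw [Ticket.advance_number, hn]⟩
  · obtain ⟨i, hi, hc⟩ := exists_countBefore_eq (r := (· < ·))
      (E := entering b t (C (t + 1)) (σ t) j) lt_irrefl_nat (fun _ _ _ => lt_trans)
      (fun _ _ _ _ hne => lt_or_gt_of_ne hne) (n := v - b.base t j) (by omega)
    refine ⟨i, _, Board.step_of_mem_entering hi, rfl, ?_⟩
    simp only [hc]
    omega

theorem next_le_succ (hp : SlackProcess P C σ) (h : BoardInvariant C σ t b) {i : ℕ} {R : Ticket}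
    (hR : (b.step t (C (t + 1)) (σ t)).ticket i = some R) :
    (b.step t (C (t + 1)) (σ t)).next R.level ≤ R.number + 25 * (t + 1 - R.enter) := by
  show b.base t R.level + (entering b t (C (t + 1)) (σ t) R.level).card ≤ _
  have h0 := h.card_entering_le hp R.level
  rcases (Board.step_cases hR).2 with ⟨h1, -, h3, -, h2⟩ | ⟨R₀, h1, h2, rfl⟩
  · omega
  · simp only [Ticket.advance_number, Ticket.advance_level, Ticket.advance_enter] at h0 ⊢
    have h3 := h.next_le i R₀ h1
    have h4 := h.base_eq h1 h2
    have h5 := h.enter_le_hop i R₀ h1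
    have h6 := h.hop_lt i R₀ h1
    omega

/-- Tickets issued now are numbered above all older ones. The gap to an older ticket still held is
bounded by the number of packets that have entered since, at most 25 per slot. -/
theorem fifo_succ (hp : SlackProcess P C σ) (h : BoardInvariant C σ t b) {i i' : ℕ} {R R' : Ticket}
    (hR : (b.step t (C (t + 1)) (σ t)).ticket i = some R)
    (hR' : (b.step t (C (t + 1)) (σ t)).ticket i' = some R') (hl : R.level = R'.level)
    (hn : R.number < R'.number) :
    R.enter ≤ R'.enter ∧ R'.number < R.number + 25 * (R'.enter + 1 - R.enter) := by
  have hnext := h.next_le_succ hp hR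
  have hlt := h.lt_next_succ hR'
  rw [← hl] at hlt
  rcases (Board.step_cases hR').2 with ⟨h1', -, h3', -, h2'⟩ | ⟨R₀', h1', h2', rfl⟩
  · rcases (Board.step_cases hR).2 with ⟨h1, -, h3, -, h2⟩ | ⟨R₀, h1, h2, rfl⟩
    · rw [h3']; omega
    · have := h.enter_le_hop i R₀ h1
      have := h.hop_lt i R₀ h1
      rw [h3']
      rw [Ticket.advance_enter] at hnext ⊢
      omega
  · rcases (Board.step_cases hR).2 with ⟨h1, -, h3, -, h2⟩ | ⟨R₀, h1, h2, rfl⟩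
    · have h4 := (h.lt_next i' R₀' h1').trans_le (next_le_base (t := t) _)
      rw [Ticket.advance_number] at hn
      rw [Ticket.advance_level] at hl
      rw [hl] at h2
      omega
    · simp only [Ticket.advance_number, Ticket.advance_level, Ticket.advance_enter] at hn hl ⊢
      exact h.fifo _ _ _ _ h1 h1' hl hn

/-- The packets in a multiplexer have similar slacks. -/
theorem slack_mem (h : BoardInvariant C σ t b) {C' : Finset ℕ} {i : ℕ} {R : Ticket}
    (hR : (b.step t C' (σ t)).ticket i = some R) :
    (if R.level = 0 then 0 else 2 ^ R.level) ≤ σ t i ∧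
      σ t i < (if R.level = 0 then 0 else 2 ^ R.level) + 4 * 2 ^ R.level := by
  have hpos : 0 < 2 ^ R.level := by positivity
  rcases (Board.step_cases hR).2 with ⟨-, h1, -⟩ | ⟨R₀, h1, h2, rfl⟩
  · have h3 := le_of_slackLevel (σ t i)
    have h4 := lt_of_slackLevel (σ t i)
    rw [← h1] at h3 h4
    split_ifs <;> omega
  · rw [Ticket.advance_level] at hpos ⊢
    have h3 := le_of_slackLevel (σ R₀.enter i)
    have h4 := lt_of_slackLevel (σ R₀.enter i)
    rw [← h.level_eq i R₀ h1] at h3 h4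
    have h5 := h.exit_le i R₀ h1
    have h6 := h.le_exit h1
    have h7 := h.slack_le i R₀ h1
    have h8 := h.enter_le_hop i R₀ h1
    have h9 := h.hop_lt i R₀ h1
    split_ifs with h10
    · rw [h10] at h5; simp only [pow_zero] at h5; omega
    · omega

/-- All numbers from `8 * (t + 1)` up to the new one are held by distinct packets of this
multiplexer. By `slack_mem` their slacks lie in a window of length `4 * 2 ^ R.level`, so there are
at most `8 * 2 ^ R.level` of them, and 8 are served per slot. -/
theorem exit_le_succ (hp : SlackProcess P C σ) (h : BoardInvariant C σ t b) {i : ℕ} {R : Ticket}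
    (hR : (b.step t (C (t + 1)) (σ t)).ticket i = some R) :
    R.exit ≤ R.enter + 2 ^ R.level := by
  classical
  rcases (Board.step_cases hR).2 with ⟨-, -, h3, -, h2⟩ | ⟨R₀, h1, h2, rfl⟩
  swap
  · rw [Ticket.advance_level, Ticket.advance_enter, Ticket.advance_exit]
    exact h.exit_le i R₀ h1
  have hlt := h.lt_next_succ hR
  have hex : ∀ v ∈ Finset.Ico (8 * (t + 1)) (R.number + 1), ∃ i R',
      (b.step t (C (t + 1)) (σ t)).ticket i = some R' ∧ R'.level = R.level ∧ R'.number = v := by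
    intro v hv
    rw [Finset.mem_Ico] at hv
    exact h.held_succ hp hv.1 (by omega)
  choose! f g hf using hex
  have h4 := hp.card_le t (if R.level = 0 then 0 else 2 ^ R.level) (4 * 2 ^ R.level)
  have h5 : (Finset.Ico (8 * (t + 1)) (R.number + 1)).card ≤ 2 * (4 * 2 ^ R.level) := by
    refine le_trans (Finset.card_le_card_of_injOn f ?_ ?_) h4
    · intro v hv
      obtain ⟨h6, h7, -⟩ := hf v hv
      have h8 := h.slack_mem h6
      rw [h7] at h8
      exact Finset.mem_coe.2 (Finset.mem_filter.2
        ⟨hp.content_succ_subset t (Board.step_cases h6).1, h8⟩)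
    · intro v hv v' hv' heq
      obtain ⟨h6, -, h8⟩ := hf v hv
      obtain ⟨h6', -, h8'⟩ := hf v' hv'
      rw [heq, h6'] at h6
      rw [← h8, ← h8', Option.some.inj h6]
  rw [Nat.card_Ico] at h5
  unfold Ticket.exit
  omega

theorem succ (hp : SlackProcess P C σ) (h : BoardInvariant C σ t b) :
    BoardInvariant C σ (t + 1) (b.step t (C (t + 1)) (σ t)) := by
  classical
  have transit : ∀ i R, (b.step t (C (t + 1)) (σ t)).ticket i = some R →
      R.enter ≤ R.hop ∧ R.hop < t + 1 ∧ t + 1 ≤ R.hop + 2 ^ R.stage ∧ R.hop < R.exit ∧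
        R.hop < R.enter + 2 ^ R.stage := by
    intro i R hR
    rcases (Board.step_cases hR).2 with ⟨-, -, h1, h2, h3⟩ | ⟨R₀, h1, h2, rfl⟩
    · have h4 : 0 < 2 ^ R.stage := by positivity
      have h5 := le_base (t := t) (b := b) R.level
      have h6 : t < R.exit := by unfold Ticket.exit; omega
      omega
    · rw [Ticket.advance_enter, Ticket.advance_exit]
      exact h.advance_transit h1 h2
  exact
  { mem_iff := by
      intro i
      refine ⟨fun hi => ?_, fun ⟨R, hR⟩ => (Board.step_cases hR).1⟩
      by_cases h1 : i ∈ deciding b t (C (t + 1))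
      · obtain ⟨R, hR, -⟩ := Board.step_of_mem_deciding (s := σ t) h1
        exact ⟨R, hR⟩
      · have h2 : ∃ R, b.ticket i = some R ∧ R.exit ≠ t := by
          by_contra! h2
          exact h1 (Finset.mem_filter.2 ⟨hi, h2⟩)
        obtain ⟨R, hR, he⟩ := h2
        exact ⟨_, Board.step_of_exit_ne hi hR he⟩
    enter_le_hop := fun i R hR => (transit i R hR).1
    hop_lt := fun i R hR => (transit i R hR).2.1
    le_hop_add := fun i R hR => (transit i R hR).2.2.1
    hop_lt_exit := fun i R hR => (transit i R hR).2.2.2.1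
    hop_lt_add := fun i R hR => (transit i R hR).2.2.2.2
    level_eq := by
      intro i R hR
      rcases (Board.step_cases hR).2 with ⟨-, h1, h2, -⟩ | ⟨R₀, h1, h2, rfl⟩
      · rw [h1, h2]
      · rw [Ticket.advance_level, Ticket.advance_enter]
        exact h.level_eq i R₀ h1
    slack_le := by
      intro i R hR
      have h0 := hp.lipschitz t i (Board.step_cases hR).1
      rcases (Board.step_cases hR).2 with ⟨-, -, h2, -⟩ | ⟨R₀, h1, h2, rfl⟩
      · rw [h2]; omega
      · rw [Ticket.advance_enter]
        have h3 := h.slack_le i R₀ h1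
        have h5 := h.enter_le_hop i R₀ h1
        have h6 := h.hop_lt i R₀ h1
        omega
    exit_le := fun i R hR => h.exit_le_succ hp hR
    lt_next := fun i R hR => h.lt_next_succ hR
    next_le := fun i R hR => h.next_le_succ hp hR
    unique := fun i i' R R' hR hR' => h.unique_succ hR hR'
    held := fun j v hv hv' => h.held_succ hp hv hv'
    fifo := fun i i' R R' hR hR' => h.fifo_succ hp hR hR' }

end BoardInvariant

theorem boardInvariant {P C : ℕ → Finset ℕ} {σ : ℕ → ℕ → ℕ} (hp : SlackProcess P C σ) (t : ℕ) :
    BoardInvariant C σ t (board C σ t) := by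
  induction t with
  | zero => exact BoardInvariant.zero hp.zero
  | succ t ih => exact ih.succ hp

/-! ### Delay lines without collisions -/

/-- Two packets in the same multiplexer that enter delay lines of the same kind in the same slot
differ in their output or in the parity of the remaining number of delays. -/
theorem BoardInvariant.line_inj {C : ℕ → Finset ℕ} {σ : ℕ → ℕ → ℕ} {t : ℕ} {b : Board}
    (h : BoardInvariant C σ t b) {i i' : ℕ} {R R' : Ticket} (hR : b.ticket i = some R)
    (hR' : b.ticket i' = some R') (hl : R.level = R'.level) (hh : R.hop = R'.hop)
    (hs : R.stage = R'.stage) (hc : R.number % 8 = R'.number % 8)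
    (hq : (R.exit - R.hop) / 2 ^ (R.stage + 1) % 2 = (R'.exit - R'.hop) / 2 ^ (R'.stage + 1) % 2) :
    i = i' := by
  wlog hle : R.number ≤ R'.number generalizing i i' R R'
  · exact (this hR' hR hl.symm hh.symm hs.symm hc.symm hq.symm (by omega)).symm
  rcases hle.eq_or_lt with heq | hlt
  · exact h.unique _ _ _ _ hR hR' hl heq
  exfalso
  obtain ⟨h1, h2⟩ := h.fifo _ _ _ _ hR hR' hl hlt
  have h3 := h.hop_lt_add i R hR
  have h3' := h.enter_le_hop i' R' hR'
  have h4 := h.hop_lt_exit i R hR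
  have h4' := h.hop_lt_exit i' R' hR'
  obtain ⟨q, hq1⟩ := exists_eq_two_pow_mul (y := R.exit - R.hop) (by omega)
  obtain ⟨q', hq1'⟩ := exists_eq_two_pow_mul (y := R'.exit - R'.hop) (by omega)
  change R.exit - R.hop = 2 ^ (R.stage + 1) * q + 2 ^ R.stage at hq1
  change R'.exit - R'.hop = 2 ^ (R'.stage + 1) * q' + 2 ^ R'.stage at hq1'
  rw [← hs] at hq1' hq
  have hX : 2 ^ R.stage < 2 ^ (R.stage + 1) := Nat.pow_lt_pow_right (by norm_num) (by omega)
  rw [hq1, hq1', Nat.mul_add_div (by positivity), Nat.mul_add_div (by positivity),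
    Nat.div_eq_of_lt hX, add_zero, add_zero] at hq
  have hexit : R.exit ≤ R'.exit ∧ R'.number - R.number = 8 * (R'.exit - R.exit) ∧
      R.exit < R'.exit := by
    unfold Ticket.exit; omega
  -- Now `q` and `q'` have the same parity, so the exits differ by at least `4 * 2 ^ R.stage` and
  -- the numbers by at least `32 * 2 ^ R.stage`. But the entries are less than `2 ^ R.stage` slots
  -- apart, so `fifo` bounds the difference of the numbers by `25 * 2 ^ R.stage`.
  have hqq : q < q' := by
    by_contra hqq
    have := Nat.mul_le_mul_left (2 ^ (R.stage + 1)) (Nat.le_of_not_lt hqq)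
    omega
  have h5 := Nat.mul_le_mul_left (2 ^ (R.stage + 1)) (show q + 2 ≤ q' by omega)
  rw [mul_add, pow_succ] at h5
  rw [pow_succ] at hq1 hq1'
  omega

/-- The delay line in which a packet is, and the slot in which it entered the line, where
`code j a c q` is the line for the packets of multiplexer `j` that have to be delayed by `2 ^ a`
before they appear at output `c`. -/
noncomputable def flight {M : ℕ} (code : ℕ → ℕ → ℕ → ℕ → Fin M) (C : ℕ → Finset ℕ)
    (σ : ℕ → ℕ → ℕ) (t i : ℕ) : Option (Fin M × ℕ) :=
  ((board C σ t).ticket i).map fun R => (code R.level R.stage (R.number % 8)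
    ((R.exit - R.hop) / 2 ^ (R.stage + 1) % 2), R.hop)

theorem flight_eq_some {M : ℕ} {code : ℕ → ℕ → ℕ → ℕ → Fin M} {C : ℕ → Finset ℕ}
    {σ : ℕ → ℕ → ℕ} {t i : ℕ} {x : Fin M × ℕ} : flight code C σ t i = some x ↔
    ∃ R, (board C σ t).ticket i = some R ∧ (code R.level R.stage (R.number % 8)
    ((R.exit - R.hop) / 2 ^ (R.stage + 1) % 2), R.hop) = x := Option.map_eq_some_iff

/-- There are `j + 1` stages at level `j`, with 8 outputs and 2 parities each, and `16 * (1 + ⋯ + L)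
= 8 * (L * (L + 1))`. -/
theorem exists_delay_lines {L M : ℕ} (hL : 1 ≤ L) (hM : 8 * (L * (L + 1)) ≤ M) :
    ∃ (delay : Fin M → ℕ) (code : ℕ → ℕ → ℕ → ℕ → Fin M), (∀ k, 0 < delay k) ∧
      (∀ j a c q, j < L → a ≤ j → c < 8 → q < 2 → delay (code j a c q) = 2 ^ a) ∧
      ∀ j a c q j' a' c' q', j < L → a ≤ j → c < 8 → q < 2 → j' < L → a' ≤ j' → c' < 8 → q' < 2 →
        code j a c q = code j' a' c' q' → j = j' ∧ a = a' ∧ c = c' ∧ q = q' := by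
  classical
  let X := ((j : Fin L) × Fin (j + 1)) × Fin 8 × Fin 2
  have hX : Fintype.card X ≤ Fintype.card (Fin M) := by
    have : ∑ j : Fin L, ((j : ℕ) + 1) = ∑ j ∈ Finset.range L, (j + 1) :=
      Fin.sum_univ_eq_sum_range (fun j => j + 1) L
    have h2 : ∑ j ∈ Finset.range L, (j + 1) = ∑ j ∈ Finset.range (L + 1), j := by
      rw [Finset.sum_range_succ' (fun j => j) L, add_zero]
    have h3 := Finset.sum_range_id_mul_two (L + 1)
    simp only [X, Fintype.card_prod, Fintype.card_sigma, Fintype.card_fin, this, h2]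
    simp only [Nat.add_sub_cancel] at h3
    have h4 : (L + 1) * L = L * (L + 1) := Nat.mul_comm _ _
    omega
  obtain ⟨f⟩ := Function.Embedding.nonempty_of_card_le hX
  -- Reduction modulo the ranges only makes the code total; it changes nothing for valid arguments.
  -- Surplus lines get delay 1 below.
  let toX : ℕ → ℕ → ℕ → ℕ → X := fun j a c q =>
    (⟨⟨j % L, Nat.mod_lt _ hL⟩, ⟨a % (j % L + 1), Nat.mod_lt _ (by simp)⟩⟩,
      ⟨c % 8, Nat.mod_lt _ (by norm_num)⟩, ⟨q % 2, Nat.mod_lt _ (by norm_num)⟩)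
  refine ⟨Function.extend f (fun x => 2 ^ (x.1.2 : ℕ)) fun _ => 1, fun j a c q => f (toX j a c q),
    fun k => ?_, fun j a c q hj ha hc hq => ?_, ?_⟩
  · by_cases h : ∃ x, f x = k
    · obtain ⟨x, rfl⟩ := h
      rw [f.injective.extend_apply]; positivity
    · rw [Function.extend_apply' _ _ _ h]; exact one_pos
  · rw [f.injective.extend_apply]
    simp only [toX, Nat.mod_eq_of_lt hj, Nat.mod_eq_of_lt (show a < j + 1 by omega)]
  · intro j a c q j' a' c' q' hj ha hc hq hj' ha' hc' hq' h
    have h1 := f.injective h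
    have e1 : j % L = j' % L := congrArg (fun x : X => (x.1.1 : ℕ)) h1
    have e2 : a % (j % L + 1) = a' % (j' % L + 1) := congrArg (fun x : X => (x.1.2 : ℕ)) h1
    have e3 : c % 8 = c' % 8 := congrArg (fun x : X => (x.2.1 : ℕ)) h1
    have e4 : q % 2 = q' % 2 := congrArg (fun x : X => (x.2.2 : ℕ)) h1
    rw [Nat.mod_eq_of_lt hj, Nat.mod_eq_of_lt (show a < j + 1 by omega), Nat.mod_eq_of_lt hj',
      Nat.mod_eq_of_lt (show a' < j' + 1 by omega)] at e2
    rw [Nat.mod_eq_of_lt hj, Nat.mod_eq_of_lt hj'] at e1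
    omega

/-! ### The schedule as an itinerary of the ideal queue -/

section construction

variable {α : Type} [LinearOrder α] {input : ℕ → SlotInput α} {B : ℕ}

theorem slackProcess (hin : DistinctPriorities input) :
    SlackProcess (population input B) (content input B) (slack input B) where
  zero := rfl
  content_succ_subset _ _ h := (mem_content_succ.1 h).1
  subset_insert _ _ h := Finset.mem_insert.2 ((mem_population.1 h).symm.imp_left And.left)
  content_subset _ _ h := mem_population.2 (Or.inl h)
  lt _ _ h := (lt_of_mem_content h).1
  lipschitz _ _ h := slack_lipschitz h
  card_le := card_slack_le hin
  removed t i hi hi' := by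
    refine slack_eq_zero (t := t) ?_
    by_contra! h
    exact hi' (mem_content_succ.2 ⟨hi, h⟩)

/-- A single line delay cannot exceed the whole wait, which is at most `2 ^ R.level`. -/
theorem stage_le_level {C : ℕ → Finset ℕ} {σ : ℕ → ℕ → ℕ} {t : ℕ} {b : Board}
    (h : BoardInvariant C σ t b) {i : ℕ} {R : Ticket} (hR : b.ticket i = some R) :
    R.stage ≤ R.level := by
  have h1 := two_pow_stage_le (h.hop_lt_exit i R hR)
  have h2 := h.exit_le i R hR
  have h3 := h.enter_le_hop i R hR
  exact (Nat.pow_le_pow_iff_right (by norm_num : 1 < 2)).1 (by omega)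

/-- Slack is at most `B / 2 < 2 ^ (L + 1)`, and the level is the logarithm of half the slack. -/
theorem slackLevel_slack_lt {L : ℕ} (hL : 1 ≤ L) (hB : B < 2 ^ (L + 2)) (t i : ℕ) :
    slackLevel (slack input B t i) < L := by
  have h1 := two_mul_slack_le (input := input) (B := B) t i
  rw [pow_add] at hB
  exact Nat.log_lt_of_lt_pow' (by omega) (by omega)

theorem flight_itinerary {L N M : ℕ} (hL : 1 ≤ L) (hB : B < 2 ^ (L + 2)) {S : SDLSystem N M}
    {code : ℕ → ℕ → ℕ → ℕ → Fin M}
    (hd : ∀ j a c q, j < L → a ≤ j → c < 8 → q < 2 → S.delay (code j a c q) = 2 ^ a)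
    (hcode : ∀ j a c q j' a' c' q', j < L → a ≤ j → c < 8 → q < 2 → j' < L → a' ≤ j' → c' < 8 →
      q' < 2 → code j a c q = code j' a' c' q' → j = j' ∧ a = a' ∧ c = c' ∧ q = q')
    (hin : DistinctPriorities input) :
    Itinerary S input (idealTrace input B) (flight code (content input B) (slack input B)) := by
  have hp := slackProcess (B := B) hin
  have inv := boardInvariant hp
  have hlev : ∀ t i R, (board (content input B) (slack input B) t).ticket i = some R →
      R.level < L := by
    intro t i R hR
    rw [(inv t).level_eq i R hR]
    exact slackLevel_slack_lt hL hB _ _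
  have hdelay : ∀ t i R, (board (content input B) (slack input B) t).ticket i = some R →
      S.delay (code R.level R.stage (R.number % 8) ((R.exit - R.hop) / 2 ^ (R.stage + 1) % 2)) =
        2 ^ R.stage := fun t i R hR =>
    hd _ _ _ _ (hlev t i R hR) (stage_le_level (inv t) hR) (Nat.mod_lt _ (by norm_num))
      (Nat.mod_lt _ (by norm_num))
  have hmem : ∀ t i, i ∈ (idealTrace input B).stored t ↔ i ∈ content input B t := fun _ _ => Iff.rfl
  have hleave : ∀ t i, (idealTrace input B).departure t = some i ∨
      (idealTrace input B).loss t = some i → i ∈ population input B t ∧ slack input B t i = 0 :=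
    fun t i h => ⟨h.elim (fun h => (departing_eq_some h).2.1) fun h => (losing_eq_some h).2.1,
      slack_eq_zero h⟩
  exact
  { stored_iff := by
      intro t i
      rw [hmem, (inv t).mem_iff]
      constructor
      · rintro ⟨R, hR⟩
        exact ⟨_, flight_eq_some.2 ⟨R, hR, rfl⟩⟩
      · rintro ⟨x, hx⟩
        obtain ⟨R, hR, -⟩ := flight_eq_some.1 hx
        exact ⟨R, hR⟩
    in_transit := by
      intro t i k s h
      obtain ⟨R, hR, heq⟩ := flight_eq_some.1 h
      obtain ⟨rfl, rfl⟩ := Prod.mk.inj heq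
      rw [hdelay t i R hR]
      exact ⟨(inv t).hop_lt i R hR, (inv t).le_hop_add i R hR⟩
    inj := by
      intro t i i' x h h'
      obtain ⟨R, hR, heq⟩ := flight_eq_some.1 h
      obtain ⟨R', hR', heq'⟩ := flight_eq_some.1 h'
      obtain ⟨h1, h2⟩ := Prod.mk.inj (heq.trans heq'.symm)
      obtain ⟨h3, h4, h5, h6⟩ := hcode _ _ _ _ _ _ _ _ (hlev t i R hR) (stage_le_level (inv t) hR)
        (Nat.mod_lt _ (by norm_num)) (Nat.mod_lt _ (by norm_num)) (hlev t i' R' hR')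
        (stage_le_level (inv t) hR') (Nat.mod_lt _ (by norm_num)) (Nat.mod_lt _ (by norm_num)) h1
      exact (inv t).line_inj hR hR' h3 h2 h4 h5 h6
    stay := by
      intro t i k s h ht
      obtain ⟨R, hR, heq⟩ := flight_eq_some.1 h
      obtain ⟨rfl, rfl⟩ := Prod.mk.inj heq
      rw [hdelay t i R hR] at ht
      have he : R.exit ≠ t := by
        have := two_pow_stage_le ((inv t).hop_lt_exit i R hR)
        omega
      -- A packet inside a line cannot be asked to leave, since that would require slack 0, and then
      -- it would be at its exit.
      have hi : i ∈ content input B (t + 1) := by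
        by_contra hi
        exact he ((inv t).exit_eq_of_slack_eq_zero hR (hp.removed t i
          (hp.content_subset t (((inv t).mem_iff i).2 ⟨R, hR⟩)) hi))
      have h1 := Board.step_of_exit_ne (s := slack input B t) hi hR he
      rw [show R.advance t = R from if_neg ht.ne'] at h1
      exact flight_eq_some.2 ⟨R, h1, rfl⟩
    move := by
      intro t i k s h ht hi
      obtain ⟨R, hR, heq⟩ := flight_eq_some.1 h
      obtain ⟨rfl, rfl⟩ := Prod.mk.inj heq
      rw [hdelay t i R hR] at ht
      by_cases he : R.exit = t
      · have h1 : i ∈ deciding (board (content input B) (slack input B) t) t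
            (content input B (t + 1)) := by
          classical
          refine Finset.mem_filter.2 ⟨hi, fun R' hR' => ?_⟩
          rw [hR] at hR'
          rw [← Option.some.inj hR', he]
        obtain ⟨R', hR', h2⟩ := Board.step_of_mem_deciding (s := slack input B t) h1
        exact ⟨_, flight_eq_some.2 ⟨R', hR', by rw [h2]⟩⟩
      · have h1 := Board.step_of_exit_ne (s := slack input B t) hi hR he
        rw [show R.advance t = { R with hop := t } from if_pos ht.symm] at h1
        exact ⟨_, flight_eq_some.2 ⟨_, h1, rfl⟩⟩
    enter := by
      intro t ht
      have h1 : t ∈ deciding (board (content input B) (slack input B) t) t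
          (content input B (t + 1)) := by
        classical
        refine Finset.mem_filter.2 ⟨ht, fun R hR => ?_⟩
        exact absurd (hp.lt t t (((inv t).mem_iff t).2 ⟨R, hR⟩)) (lt_irrefl t)
      obtain ⟨R', hR', h2⟩ := Board.step_of_mem_deciding (s := slack input B t) h1
      exact ⟨_, flight_eq_some.2 ⟨R', hR', by rw [h2]⟩⟩
    leave := by
      intro t i h hi
      obtain ⟨R, hR⟩ := ((inv t).mem_iff i).1 hi
      refine ⟨_, _, flight_eq_some.2 ⟨R, hR, rfl⟩, ?_⟩
      rw [hdelay t i R hR]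
      have h1 := (inv t).exit_eq_of_slack_eq_zero hR (hleave t i h).2
      have h2 := two_pow_stage_le ((inv t).hop_lt_exit i R hR)
      have h3 := (inv t).le_hop_add i R hR
      omega
    stored_succ := by
      intro t i
      rw [hmem, hmem, mem_content_succ, mem_population]
      rfl
    leave_present := fun t i h => mem_population.1 (hleave t i h).1
    departure_ne_loss := fun t i h => departing_ne_losing h }

end construction

theorem flight_congr {α : Type} [LinearOrder α] {input input' : ℕ → SlotInput α} {B M t : ℕ}
    (code : ℕ → ℕ → ℕ → ℕ → Fin M) (h : ∀ s < t, input s = input' s) :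
    flight code (content input B) (slack input B) t =
      flight code (content input' B) (slack input' B) t := by
  have h1 := board_congr (t := t) (C := content input B) (C' := content input' B)
    (σ := slack input B) (σ' := slack input' B)
    (fun s hs => content_congr fun r hr => h r (by omega))
    (fun s hs => slack_congr fun r hr => h r (by omega))
  funext i
  unfold flight
  rw [h1]

/-- With `L` levels of multiplexers, a priority queue whose buffer is less than `2 ^ (L + 2)` can be
constructed. -/
theorem priorityQueueConstructible {B L N M : ℕ} (hL : 1 ≤ L) (hB : B < 2 ^ (L + 2))
    (hM : 8 * (L * (L + 1)) ≤ M) (hN : M + 2 ≤ N) : PriorityQueueConstructible B N M := by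
  obtain ⟨delay, code, hpos, hd, hcode⟩ := exists_delay_lines hL hM
  refine ⟨⟨hN, delay, hpos⟩, fun α _ => ?_⟩
  obtain ⟨ctrl, hctrl⟩ := exists_controller (α := α) ⟨hN, delay, hpos⟩ (fun input => idealTrace input B)
    (fun input => flight code (content input B) (slack input B)) (fun input input' t h =>
      ⟨flight_congr code fun s hs => h s hs.le, flight_congr code fun s hs => h s (by omega),
        idealTrace_congr h⟩)
  refine ⟨ctrl, fun input hin => ?_⟩
  rw [hctrl input (flight_itinerary hL hB hd hcode hin)]
  exact idealTrace_isPriorityQueue hin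

end OpticalQueue

/-! ### Choice of the number of levels -/

theorem mainTheorem3 :
    (∀ m : ℕ, 1 ≤ m →
      OpticalQueue.PriorityQueueConstructible (3 * 2 ^ (m - 1) - 2) (12 * m ^ 2 + 56 * m - 2)
        (12 * (m ^ 2 + 3 - 2 * m))) ∧
    ∃ c : ℝ, 0 < c ∧ ∀ᶠ M : ℕ in Filter.atTop, ∃ B : ℕ,
      (2 : ℝ) ^ (c * Real.sqrt (M : ℝ)) ≤ (B : ℝ) ∧
      OpticalQueue.PriorityQueueConstructible B (M + 2) M := by
  refine ⟨fun m hm => ?_, 1 / 8, by norm_num, ?_⟩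
  · obtain ⟨k, rfl⟩ : ∃ k, m = k + 1 := ⟨m - 1, by omega⟩
    have e1 : (k + 1) ^ 2 + 3 - 2 * (k + 1) = k ^ 2 + 2 := by
      have : (k + 1) ^ 2 = k ^ 2 + 2 * k + 1 := by ring
      omega
    have e2 : (k + 1) ^ 2 = k ^ 2 + 2 * k + 1 := by ring
    rw [e1, Nat.add_sub_cancel]
    have hpow : 0 < 2 ^ k := by positivity
    -- With `k = m - 1`, the buffer `3 * 2 ^ k - 2` is below `2 ^ (k + 2)`, so `k` levels suffice;
    -- the maximum covers `k = 0`. The line count holds because `8 * k * (k + 1) ≤ 12 * (k ^ 2 +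
    -- 2)`.
    refine OpticalQueue.priorityQueueConstructible (L := max k 1) (le_max_right _ _) ?_ ?_
      (by omega)
    · have : 2 ^ (k + 2) ≤ 2 ^ (max k 1 + 2) := Nat.pow_le_pow_right (by norm_num) (by omega)
      rw [pow_add] at this
      omega
    · rcases Nat.eq_zero_or_pos k with rfl | hk
      · norm_num
      · rw [max_eq_left hk]
        zify
        nlinarith [sq_nonneg ((k : ℤ) - 1)]
  · filter_upwards [Filter.eventually_ge_atTop 16] with M hM
    have h4 : 4 ≤ Nat.sqrt M := Nat.le_sqrt.2 (by omega)
    -- For `L = Nat.sqrt M / 4 ≥ 1` one has `8 * L * (L + 1) ≤ 16 * L ^ 2 ≤ M`. The constant `1 / 8`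
    -- absorbs both roundings, since `Nat.sqrt M + 1 ≤ 8 * L` once `Nat.sqrt M ≥ 4`.
    refine ⟨2 ^ (Nat.sqrt M / 4), ?_, ?_⟩
    · have h1 : Real.sqrt M ≤ Nat.sqrt M + 1 := Real.real_sqrt_le_nat_sqrt_succ
      have h2 : (Nat.sqrt M : ℝ) + 1 ≤ 8 * (Nat.sqrt M / 4 : ℕ) := by
        exact_mod_cast (by omega : Nat.sqrt M + 1 ≤ 8 * (Nat.sqrt M / 4))
      push_cast
      rw [← Real.rpow_natCast]
      exact Real.rpow_le_rpow_of_exponent_le (by norm_num) (by linarith)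
    · refine OpticalQueue.priorityQueueConstructible (L := Nat.sqrt M / 4) (by omega)
        (Nat.pow_lt_pow_right (by norm_num) (by omega)) ?_ le_rfl
      have h3 := Nat.sqrt_le M
      generalize hk : Nat.sqrt M / 4 = k
      have h5 : 4 * k ≤ Nat.sqrt M := by omega
      have h6 : 1 ≤ k := by omega
      nlinarith [Nat.mul_le_mul h5 h5]
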